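/- Let $k$ be a non-archimedean local field (for instance, the completion of a number field at a finite place), with ring of integers $\mathfrak o$, residue field of $q$ elements and normalized absolute value $|\cdot|$, and assume that $2$ is a unit in $\mathfrak o$. Let $n\ge 0$ be even. Equip $k^{n+3}=k e_+\oplus k^{n+1}\oplus k e_-$ with the quadratic form which is the orthogonal sum of $\langle e_+,e_+\rangle=1$, of a form on $k^{n+1}$ whose Gram matrix $S$ is symmetric with entries in $\mathfrak o$ and $\det S\in\mathfrak o^\times$, and of $\langle e_-,e_-\rangle=-1$. Let $\Delta=(-1)^{n/2+1}\det S\in\mathfrak o^\times$ be the discriminant of the form on $k^{n+2}=ke_+\oplus k^{n+1}$ (normalized so that hyperbolic planes have discriminant $1$), and let $\varepsilon=\chi(\Delta)$, where $\chi$ is the non-trivial character of $\mathfrak o^\times/(\mathfrak o^\times)^2$; thus $\varepsilon=1$ if $\Delta$ is a square and $\varepsilon=-1$ otherwise. Write $$Z(\alpha)=\frac1{1-q^{-\alpha}},\qquad L(\alpha,\chi)=\frac1{1-\varepsilon q^{-\alpha}}.$$ Let $G=\mathrm O(n+3)$ be the isometry group of $k^{n+3}$, acting from the right, let $H=\mathrm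 O(n+2)$ be the fixer of $e_-$ in $G$, and let $\Theta=\mathrm O(n+1)$ be the fixer of $e_+$ and $e_-$. With $e=e_++e_-$, $\Phi$ the characteristic function of $\mathfrak o^{n+3}$, and $dt$ a Haar measure on $k^\times$, put $$\varphi_s(g)=\int_{k^\times}|t|^{(n+1)s}\,\Phi(te\cdot g)\,dt,\qquad \varphi^\circ_s(g)=\frac{\varphi_s(g)}{\varphi_s(1)}\qquad(g\in G);$$ $\varphi_s^\circ$ is left $\Theta$-invariant. Let $dh$ be a (nonzero, Radon) right $H$-invariant measure on $\Theta\backslash H$. Then there is a constant $C>0$, not depending on $s$, such that for every $s\in\mathbb C$ with $(n+1)\operatorname{Re}(s)>n$ the integrals defining $\varphi_s(h)$, for $h\in H$, converge absolutely, $\varphi_s(1)\ne0$, $\varphi_s^\circ$ is integrable on $\Theta\backslash H$, and $$\int_{\Theta\backslash H}\varphi_s^\circ(h)\,dh = C\cdot\frac{Z\bigl((n+1)(s-1)+1\bigr)\cdot L\bigl((n+1)(s-\tfrac12)+\tfrac12,\chi\bigr)}{Z\bigl((n+1)(2s-1)+1\bigr)}.$$ The cases $n=0$ and $n=2$ are included.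 -/

import Mathlib

open scoped Matrix
open MeasureTheory

noncomputable section

namespace OrthogonalPeriod

section LocalField

variable (K : Type*) [NontriviallyNormedField K] [IsUltrametricDist K]

/-- The number `q` of elements of the residue field of the ring of integers `{x | ‖x‖ ≤ 1}`. -/
def residueCard : ℕ :=
  Nat.card (IsLocalRing.ResidueField (NormedField.valuation (K := K)).valuationSubring)

/-- The absolute value of `K` is the normalized one: uniformizers exist (elements whose absolute
value is the largest one below `1`) and have absolute value `1 / q`. -/
def IsNormalizedAbs : Prop :=
  IsGreatest {r : ℝ | ∃ x : K, ‖x‖ = r ∧ r < 1} ((residueCard K : ℝ)⁻¹)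

/-- The local zeta factor `Z(α) = 1 / (1 - q ^ (-α))`. -/
def zetaFactor (α : ℂ) : ℂ := 1 / (1 - (residueCard K : ℂ) ^ (-α))

variable {K}

open Classical in
/-- The non-trivial character `χ` of `𝔬ˣ / (𝔬ˣ)²`, on a unit `u` of the ring of integers `𝔬`
(a unit is a square in `𝔬ˣ` exactly when it is one in `K`). -/
def quadChar (u : K) : ℤ := if IsSquare u then 1 else -1

/-- The local factor `L(α, χ) = 1 / (1 - ε q ^ (-α))` with `ε = χ(Δ)`. -/
def LFactor (Δ : K) (α : ℂ) : ℂ :=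
  1 / (1 - (quadChar Δ : ℂ) * (residueCard K : ℂ) ^ (-α))

end LocalField

/-- Coordinates on `k ^ (n + 3) = k e₊ ⊕ k ^ (n + 1) ⊕ k e₋`. -/
abbrev Idx (n : ℕ) : Type := Unit ⊕ (Fin (n + 1) ⊕ Unit)

section Groups

variable {K : Type*} [NontriviallyNormedField K] {n : ℕ}

/-- The vector `e₊`. -/
def ePlus (K : Type*) [NontriviallyNormedField K] (n : ℕ) : Idx n → K :=
  Pi.single (Sum.inl ()) 1

/-- The vector `e₋`. -/
def eMinus (K : Type*) [NontriviallyNormedField K] (n : ℕ) : Idx n → K :=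
  Pi.single (Sum.inr (Sum.inr ())) 1

/-- The Gram matrix of the form on `k ^ (n + 3)`, the orthogonal sum of `⟨e₊, e₊⟩ = 1`, of the
form with Gram matrix `S` on `k ^ (n + 1)`, and of `⟨e₋, e₋⟩ = -1`. -/
def gram (S : Matrix (Fin (n + 1)) (Fin (n + 1)) K) : Matrix (Idx n) (Idx n) K :=
  Matrix.fromBlocks 1 0 0 (Matrix.fromBlocks S 0 0 (-1))

/-- The discriminant `Δ = (-1) ^ (n / 2 + 1) det` of the form on `k ^ (n + 2) = k e₊ ⊕ k ^ (n + 1)`,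
for `n` even; it is normalized so that hyperbolic planes have discriminant `1`. -/
def discr (S : Matrix (Fin (n + 1)) (Fin (n + 1)) K) : K := (-1) ^ (n / 2 + 1) * S.det

/-- `G = O(n + 3)`: the isometries of the form on `k ^ (n + 3)`, which act on row vectors from the
right, `v · g = v ᵥ* g`. -/
def G (S : Matrix (Fin (n + 1)) (Fin (n + 1)) K) : Subgroup (GL (Idx n) K) where
  carrier := {g | g.1 * gram S * g.1ᵀ = gram S}
  one_mem' := by simp
  mul_mem' := by
    intro a b ha hb
    simp only [Set.mem_ofPred_eq] at ha hb ⊢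
    calc (a * b).1 * gram S * (a * b).1ᵀ
        = a.1 * (b.1 * gram S * b.1ᵀ) * a.1ᵀ := by
          simp only [Units.val_mul, Matrix.transpose_mul, Matrix.mul_assoc]
      _ = gram S := by rw [hb, ha]
  inv_mem' := by
    intro a ha
    simp only [Set.mem_ofPred_eq] at ha ⊢
    have h1 : (a⁻¹).1 * a.1 = 1 := a.inv_mul
    have h2 : a.1ᵀ * (a⁻¹).1ᵀ = 1 := by
      rw [← Matrix.transpose_mul, h1, Matrix.transpose_one]
    calc (a⁻¹).1 * gram S * (a⁻¹).1ᵀ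
        = (a⁻¹).1 * (a.1 * gram S * a.1ᵀ) * (a⁻¹).1ᵀ := by rw [ha]
      _ = ((a⁻¹).1 * a.1) * gram S * (a.1ᵀ * (a⁻¹).1ᵀ) := by simp only [Matrix.mul_assoc]
      _ = gram S := by rw [h1, h2, Matrix.one_mul, Matrix.mul_one]

/-- The fixer of a row vector in `GL`. -/
def fixer (v : Idx n → K) : Subgroup (GL (Idx n) K) where
  carrier := {g | v ᵥ* g.1 = v}
  one_mem' := by simp
  mul_mem' := by
    intro a b ha hb
    simp only [Set.mem_ofPred_eq] at ha hb ⊢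
    rw [Units.val_mul, ← Matrix.vecMul_vecMul, ha, hb]
  inv_mem' := by
    intro a ha
    simp only [Set.mem_ofPred_eq] at ha ⊢
    have h1 : a.1 * (a⁻¹).1 = 1 := a.mul_inv
    calc v ᵥ* (a⁻¹).1 = (v ᵥ* a.1) ᵥ* (a⁻¹).1 := by rw [ha]
      _ = v := by rw [Matrix.vecMul_vecMul, h1, Matrix.vecMul_one]

/-- `H = O(n + 2)`: the isometries of `k ^ (n + 2) = e₋ᗮ`, that is, the fixer of `e₋` in `G`. -/
def H (S : Matrix (Fin (n + 1)) (Fin (n + 1)) K) : Subgroup (GL (Idx n) K) :=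
  G S ⊓ fixer (eMinus K n)

/-- `Θ = O(n + 1)`, as a subgroup of `H`: the fixer of `e₊` and `e₋`. -/
def Theta (S : Matrix (Fin (n + 1)) (Fin (n + 1)) K) : Subgroup (H S) :=
  (fixer (ePlus K n)).subgroupOf (H S)

/-- The homogeneous space `Θ \ H` of cosets `Θ h`. -/
def ThetaQuot (S : Matrix (Fin (n + 1)) (Fin (n + 1)) K) : Type _ :=
  Quotient (QuotientGroup.rightRel (Theta S))

instance (S : Matrix (Fin (n + 1)) (Fin (n + 1)) K) : TopologicalSpace (ThetaQuot S) :=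
  inferInstanceAs (TopologicalSpace (Quotient (QuotientGroup.rightRel (Theta S))))

instance (S : Matrix (Fin (n + 1)) (Fin (n + 1)) K) : MeasurableSpace (ThetaQuot S) :=
  borel _

instance (S : Matrix (Fin (n + 1)) (Fin (n + 1)) K) : BorelSpace (ThetaQuot S) := ⟨rfl⟩

/-- The right translation `Θ x ↦ Θ x h` of `Θ \ H` by an element `h` of `H`. -/
def translate (S : Matrix (Fin (n + 1)) (Fin (n + 1)) K) (h : H S) :
    ThetaQuot S → ThetaQuot S :=
  Quotient.map' (· * h) (by
    intro a b hab
    rw [QuotientGroup.rightRel_apply] at hab ⊢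
    simpa [mul_assoc] using hab)

/-- A right `H`-invariant measure on `Θ \ H`: nonzero, finite on compact sets, and invariant under
all right translations. -/
structure IsInvariant (S : Matrix (Fin (n + 1)) (Fin (n + 1)) K)
    (μ : Measure (ThetaQuot S)) : Prop where
  ne_zero : μ ≠ 0
  finiteOnCompacts : IsFiniteMeasureOnCompacts μ
  map_translate : ∀ h : H S, μ.map (translate S h) = μ

/-- The characteristic function `Φ` of `𝔬 ^ (n + 3)`. -/
def Phi (v : Idx n → K) : ℂ := Set.indicator {w : Idx n → K | ∀ i, ‖w i‖ ≤ 1} 1 v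

/-- The integrand `|t| ^ α Φ(t e · g)` of the spherical function, where `e = e₊ + e₋` and
`α = (n + 1) s`. -/
def integrand (s : ℂ) (g : GL (Idx n) K) (t : Kˣ) : ℂ :=
  ((‖(t : K)‖ : ℝ) : ℂ) ^ ((n + 1 : ℂ) * s) *
    Phi (((t : K) • (ePlus K n + eMinus K n)) ᵥ* g.1)

variable [MeasurableSpace K]

/-- The function `φ(g) = ∫ |t| ^ α Φ(t e · g) dt` with respect to a measure `dt` on `kˣ`. -/
def phi (τ : Measure Kˣ) (s : ℂ) (g : GL (Idx n) K) : ℂ := ∫ t, integrand s g t ∂τ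

/-- The normalized spherical function `φ°(g) = φ(g) / φ(1)`. -/
def phiNormalized (τ : Measure Kˣ) (s : ℂ) (g : GL (Idx n) K) : ℂ := 
  phi τ s g / phi τ s (1 : GL (Idx n) K)

theorem phiNormalized_theta_mul (S : Matrix (Fin (n + 1)) (Fin (n + 1)) K) (τ : Measure Kˣ)
    (s : ℂ) (θ : H S) (hθ : θ ∈ Theta S) (h : H S) :
    phiNormalized τ s ((θ * h : H S) : GL (Idx n) K) = phiNormalized τ s (h : GL (Idx n) K) := by
  have h1 : ePlus K n ᵥ* (θ : GL (Idx n) K).1 = ePlus K n := hθ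
  have h2 : eMinus K n ᵥ* (θ : GL (Idx n) K).1 = eMinus K n := θ.2.2
  have key : ∀ t : Kˣ, integrand s ((θ * h : H S) : GL (Idx n) K) t
      = integrand s (h : GL (Idx n) K) t := by
    intro t
    unfold integrand
    rw [Subgroup.coe_mul, Units.val_mul, ← Matrix.vecMul_vecMul, Matrix.smul_vecMul,
      Matrix.add_vecMul, h1, h2]
  simp only [phiNormalized, phi, key]

/-- The normalized spherical function, restricted to `H`, as a function on `Θ \ H`. -/
def phiQuot (S : Matrix (Fin (n + 1)) (Fin (n + 1)) K) (τ : Measure Kˣ) (s : ℂ) :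
    ThetaQuot S → ℂ :=
  Quotient.lift (fun h : H S => phiNormalized τ s (h : GL (Idx n) K)) (by
    intro a b hab
    have hab' : b * a⁻¹ ∈ Theta S := QuotientGroup.rightRel_apply.mp hab
    have := phiNormalized_theta_mul S τ s (b * a⁻¹) hab' a
    rw [inv_mul_cancel_right] at this
    exact this.symm)

end Groups

end OrthogonalPeriod

end

/-! Write $n=2r$, $\alpha=(n+1)s$. Substituting in $t$ shows that $\varphi_s(g)$ depends on $g$ only
through the sup norm of $e\cdot g$: `phiNormalized_eq` gives $\varphi_s^\circ(g)=\|e\cdot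
g\|^{-\alpha}$. For $h\in H$ one has $e\cdot h=e_+h+e_-$, where $e_+h$ lies on the quadric
$Q=\{\mathrm{qf}=1\}$ in $k^{n+2}$. Points of $Q$ have norm at least $1$ because the form is
integral, so $\|e\cdot h\|=\|e_+h\|$. The map $\Theta h\mapsto e_+h$ is injective and equivariant,
so the period is the integral of $\|v\|^{-\alpha}$ against an invariant measure carried by $Q$.
Surjectivity onto $Q$ is never needed.

Such a measure is unique up to a scalar (`IsQuadricMeasure.eq_smul`). Only invariance under
reflections and their negatives is used: they act transitively on $Q$, and those joining nearby
points of an integral unit ball preserve the sup norm, so balls of equal radius have equal mass. The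
measure can therefore be replaced by an explicit one: Haar measure on $\{v:\mathrm{qf}(v)\in
1+\mathfrak p\}$ pushed to $Q$ by $v\mapsto v/\sqrt{\mathrm{qf}(v)}$. The square root is a unit, so
norms do not change, and the integral becomes a Haar integral over an open set.

That integral is computed on the shells $\|v\|=q^m$ (`integral_nearOne_norm_cpow`). Let $V$ be the
volume of $\mathfrak p^{n+2}$. Hensel-type equidistribution reduces shell volumes to point counts
over the residue field. Shell $0$ has volume $A_0V$ with $A_0=q^r(q^{r+1}-\varepsilon)$ the number
of solutions of $\mathrm{qf}=1$. Shell $m\ge1$ has volume $q^{2rm}A_1V$ with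
$A_1=(q^r+\varepsilon)(q^{r+1}-\varepsilon)$ the number of nonzero isotropic vectors. Both counts
come from Gauss sums (`card_quadric`). The geometric series sums to a constant times $(1+\varepsilon
q^{r-\alpha})/(1-q^{2r-\alpha})$. Writing $1+\varepsilon x=(1-x^2)/(1-\varepsilon x)$ with
$x=q^{r-\alpha}$ turns this into the stated quotient (`factors_eq`). -/

noncomputable section

namespace OrthogonalPeriod

/-! ### Point counts on quadrics over finite fields, by Gauss sums -/

section FiniteField

variable {F : Type*} [Field F] [Fintype F] [DecidableEq F] {ι : Type*} [Fintype ι] [DecidableEq ι]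

/-- A symmetric matrix over a field of characteristic not two is congruent to a diagonal one. -/
theorem exists_diagonalization {F : Type*} [Field F] (h2 : (2 : F) ≠ 0)
    (B : Matrix ι ι F) (hB : B.IsSymm) :
    ∃ (P : Matrix ι ι F) (d : ι → F), IsUnit P.det ∧ P * B * Pᵀ = Matrix.diagonal d := by
  have : Invertible (2 : F) := invertibleOfNonzero h2
  have hsymm : LinearMap.IsSymm (Matrix.toBilin' B) := by
    refine ⟨fun x y => ?_⟩
    simp only [Matrix.toBilin'_apply', RingHom.id_apply]
    rw [Matrix.dotProduct_mulVec, ← Matrix.mulVec_transpose, hB.eq, dotProduct_comm]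
  obtain ⟨v, hv⟩ := LinearMap.BilinForm.exists_orthogonal_basis hsymm
  let e : Fin (Module.finrank F (ι → F)) ≃ ι :=
    (finCongr (by simp)).trans (Fintype.equivFin ι).symm
  let w := v.reindex e
  have key : ∀ i j, i ≠ j → w i ⬝ᵥ B *ᵥ w j = 0 := by
    intro i j hij
    have := hv (i := e.symm i) (j := e.symm j) (by simpa using hij)
    simpa [Matrix.toBilin'_apply', w] using this
  refine ⟨Matrix.of fun i => w i, fun i => w i ⬝ᵥ B *ᵥ w i, ?_, ?_⟩
  · have : (Pi.basisFun F ι).toMatrix w = (Matrix.of fun i => w i)ᵀ := by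
      ext i j; simp [Module.Basis.toMatrix_apply]
    rw [← Matrix.det_transpose, ← this, ← Module.Basis.det_apply]
    exact Module.Basis.isUnit_det _ _
  · ext i j
    have : (Matrix.of (fun i => w i) * B * (Matrix.of fun i => w i)ᵀ) i j = w i ⬝ᵥ B *ᵥ w j := by
      rw [Matrix.mul_assoc, Matrix.mul_apply']
      congr 1
    rw [this]
    by_cases h : i = j
    · subst h; simp
    · rw [key i j h, Matrix.diagonal_apply_ne _ h]

/-- The quadratic character with complex values. -/
def quadCharC (F : Type*) [Field F] [Fintype F] [DecidableEq F] : MulChar F ℂ :=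
  (quadraticChar F).ringHomComp (Int.castRingHom ℂ)

theorem quadCharC_apply (a : F) : quadCharC F a = (quadraticChar F a : ℂ) := rfl

/-- The equation $x^2=y$ has $1+\chi(y)$ solutions. The part with $1$ sums to zero because $\psi$ is
primitive, and the part with $\chi$ is a twisted Gauss sum. -/
theorem sum_addChar_mul_sq (hF : ringChar F ≠ 2) (ψ : AddChar F ℂ) (hψ : ψ.IsPrimitive)
    {a : F} (ha : a ≠ 0) :
    ∑ x, ψ (a * x ^ 2) = quadCharC F a * gaussSum (quadCharC F) ψ := by
  have h1 : ∑ x : F, ψ (a * x ^ 2) = ∑ y : F, (1 + quadCharC F y) * ψ (a * y) := by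
    rw [← Finset.sum_fiberwise (s := Finset.univ) (g := fun x : F => x ^ 2)]
    refine Finset.sum_congr rfl fun y _ => ?_
    have : ∀ x ∈ Finset.univ.filter (fun x : F => x ^ 2 = y), ψ (a * x ^ 2) = ψ (a * y) := by
      intro x hx
      rw [(Finset.mem_filter.mp hx).2]
    rw [Finset.sum_congr rfl this, Finset.sum_const, nsmul_eq_mul]
    congr 1
    have := quadraticChar_card_sqrts hF y
    rw [quadCharC_apply, add_comm, ← Int.cast_one, ← Int.cast_add, ← this]
    simp
  have h2 : ∑ y, ψ (a * y) = 0 := by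
    have := AddChar.sum_mulShift a hψ
    simp only [ha, if_false] at this
    simpa [mul_comm] using this
  have h3 := gaussSum_mulShift (quadCharC F) ψ (Units.mk0 a ha)
  have h4 : quadCharC F a * quadCharC F a = 1 := by
    rw [quadCharC_apply]
    have := quadraticChar_sq_one ha
    rw [sq] at this
    exact_mod_cast this
  simp only [Units.val_mk0] at h3
  rw [h1, ← h3, ← mul_assoc, h4, one_mul]
  simp only [add_mul, one_mul, Finset.sum_add_distrib, h2, zero_add]
  simp [gaussSum, AddChar.mulShift_apply]

theorem gaussSum_quadCharC_sq (hF : ringChar F ≠ 2) (ψ : AddChar F ℂ) (hψ : ψ.IsPrimitive) :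
    gaussSum (quadCharC F) ψ ^ 2 = quadCharC F (-1) * Fintype.card F := by
  refine gaussSum_sq ?_ ?_ hψ
  · intro h
    obtain ⟨a, ha⟩ := quadraticChar_exists_neg_one' hF
    have := congrArg (fun χ : MulChar F ℂ => χ a) h
    simp only [quadCharC_apply, ha, MulChar.one_apply_coe] at this
    norm_num at this
  · exact (quadraticChar_isQuadratic F).comp _

/-- After diagonalization the sum is a product of one-variable Gauss sums. With an even number of
variables, $t$ enters only through the square $t^{2r}$, so the value does not depend on $t\ne0$;
this is what makes the point count elementary. -/
theorem sum_addChar_quadForm (hF : ringChar F ≠ 2) (ψ : AddChar F ℂ) (hψ : ψ.IsPrimitive)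
    (B : Matrix ι ι F) (hB : B.IsSymm) (hdet : B.det ≠ 0) {r : ℕ} (hr : Fintype.card ι = 2 * r)
    {t : F} (ht : t ≠ 0) :
    ∑ v : ι → F, ψ (t * (v ⬝ᵥ B *ᵥ v)) =
      quadCharC F ((-1) ^ r * B.det) * (Fintype.card F : ℂ) ^ r := by
  have h2 : (2 : F) ≠ 0 := Ring.two_ne_zero hF
  obtain ⟨P, d, hP, hd⟩ := exists_diagonalization h2 B hB
  have hdetd : P.det ^ 2 * B.det = ∏ i, d i := by
    rw [← Matrix.det_diagonal, ← hd, Matrix.det_mul, Matrix.det_mul, Matrix.det_transpose]; ring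
  have hd0 : ∀ i, d i ≠ 0 := by
    have : ∏ i, d i ≠ 0 := by
      rw [← hdetd]; exact mul_ne_zero (pow_ne_zero _ hP.ne_zero) hdet
    intro i hi
    exact this (Finset.prod_eq_zero (Finset.mem_univ i) hi)
  have hPu : IsUnit P := (Matrix.isUnit_iff_isUnit_det P).2 hP
  have hbij : Function.Bijective (fun y : ι → F => y ᵥ* P) :=
    ⟨Matrix.vecMul_injective_of_isUnit hPu, fun v => ⟨v ᵥ* P⁻¹, by
      simp [Matrix.vecMul_vecMul, Matrix.nonsing_inv_mul _ hP]⟩⟩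
  rw [← hbij.sum_comp]
  have hval : ∀ y : ι → F, (y ᵥ* P) ⬝ᵥ B *ᵥ (y ᵥ* P) = ∑ i, d i * y i ^ 2 := by
    intro y
    have : (y ᵥ* P) ⬝ᵥ B *ᵥ (y ᵥ* P) = y ⬝ᵥ (P * B * Pᵀ) *ᵥ y := by
      rw [← Matrix.mulVec_transpose P y, Matrix.mulVec_mulVec, Matrix.mulVec_transpose,
        ← Matrix.dotProduct_mulVec, Matrix.mulVec_mulVec, ← Matrix.mul_assoc]
    rw [this, hd, dotProduct]
    refine Finset.sum_congr rfl fun i _ => ?_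
    rw [Matrix.mulVec_diagonal]; ring
  simp only [hval, Finset.mul_sum]
  have hprod : ∀ y : ι → F, ψ (∑ i, t * (d i * y i ^ 2)) = ∏ i, ψ (t * d i * y i ^ 2) := by
    intro y
    have := map_prod ψ.toMonoidHom (fun i => Multiplicative.ofAdd (t * (d i * y i ^ 2))) Finset.univ
    rw [← ofAdd_sum] at this
    simp only [mul_assoc]
    exact this
  simp only [hprod]
  have := Finset.prod_univ_sum (fun _ : ι => (Finset.univ : Finset F))
    (fun i x => ψ (t * d i * x ^ 2))
  rw [Fintype.piFinset_univ] at this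
  rw [← this]
  simp only [sum_addChar_mul_sq hF ψ hψ (mul_ne_zero ht (hd0 _))]
  rw [Finset.prod_mul_distrib, Finset.prod_const, Finset.card_univ, hr, pow_mul,
    gaussSum_quadCharC_sq hF ψ hψ, ← map_prod, Finset.prod_mul_distrib, Finset.prod_const,
    Finset.card_univ, hr, ← hdetd, pow_mul, mul_pow, ← mul_assoc, ← map_pow, ← map_mul]
  congr 1
  have hsq : ∀ x : F, x ≠ 0 → quadCharC F (x ^ 2) = 1 := by
    intro x hx
    rw [quadCharC_apply, quadraticChar_sq_one' hx]; simp
  have : (t ^ 2) ^ r * (P.det ^ 2 * B.det) * (-1) ^ r = (t ^ r * P.det) ^ 2 * ((-1) ^ r * B.det) := by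
    ring
  rw [this, map_mul, hsq _ (mul_ne_zero (pow_ne_zero _ ht) hP.ne_zero), one_mul]

/-- The number of points of an affine quadric in an even number of variables. -/
theorem card_quadric (hF : ringChar F ≠ 2)
    (B : Matrix ι ι F) (hB : B.IsSymm) (hdet : B.det ≠ 0) {r : ℕ} (hr : Fintype.card ι = 2 * r)
    (c : F) :
    (Fintype.card F : ℤ) * (Finset.univ.filter fun v : ι → F => v ⬝ᵥ B *ᵥ v = c).card =
      (Fintype.card F : ℤ) ^ (2 * r) + quadraticChar F ((-1) ^ r * B.det) *
        (Fintype.card F : ℤ) ^ r * (if c = 0 then (Fintype.card F : ℤ) - 1 else -1) := by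
  let ψ := AddChar.FiniteField.primitiveChar_to_Complex F
  have hψ : ψ.IsPrimitive := AddChar.FiniteField.primitiveChar_to_Complex_isPrimitive F
  have key : ((Fintype.card F : ℂ)) *
      (Finset.univ.filter fun v : ι → F => v ⬝ᵥ B *ᵥ v = c).card =
      (Fintype.card F : ℂ) ^ (2 * r) + quadCharC F ((-1) ^ r * B.det) *
        (Fintype.card F : ℂ) ^ r * (if c = 0 then (Fintype.card F : ℂ) - 1 else -1) := by
    -- Orthogonality of characters detects the equation. The term $t=0$ gives the main term
    -- $q^{2r}$, and the terms $t\neq0$ give a constant times $\sum_{t\ne0}\psi(-tc)$, which is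
    -- $q-1$ or $-1$.
    have h1 : ∑ t : F, ∑ v : ι → F, ψ (t * (v ⬝ᵥ B *ᵥ v - c)) = (Fintype.card F : ℂ) *
        (Finset.univ.filter fun v : ι → F => v ⬝ᵥ B *ᵥ v = c).card := by
      rw [Finset.sum_comm]
      simp only [AddChar.sum_mulShift _ hψ, sub_eq_zero]
      rw [Finset.card_filter]
      push_cast
      rw [Finset.mul_sum]
      exact Finset.sum_congr rfl fun v _ => by split_ifs <;> simp
    rw [← h1, ← Finset.add_sum_erase _ _ (Finset.mem_univ (0 : F))]
    congr 1
    · simp [hr]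
    · have h3 : ∀ t ∈ Finset.univ.erase (0 : F), ∑ v : ι → F, ψ (t * (v ⬝ᵥ B *ᵥ v - c)) =
          quadCharC F ((-1) ^ r * B.det) * (Fintype.card F : ℂ) ^ r * ψ (t * (-c)) := by
        intro t ht
        rw [← sum_addChar_quadForm hF ψ hψ B hB hdet hr (Finset.ne_of_mem_erase ht),
          Finset.sum_mul]
        refine Finset.sum_congr rfl fun v _ => ?_
        rw [← AddChar.map_add_eq_mul]; congr 1; ring
      rw [Finset.sum_congr rfl h3, ← Finset.mul_sum]
      congr 1
      have h4 := AddChar.sum_mulShift (-c) hψ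
      rw [← Finset.add_sum_erase _ _ (Finset.mem_univ (0 : F))] at h4
      simp only [zero_mul, AddChar.map_zero_eq_one, neg_eq_zero] at h4
      split_ifs at h4 ⊢ with hc
      · linear_combination h4
      · push_cast at h4; linear_combination h4
  rw [quadCharC_apply] at key
  split_ifs at key ⊢ <;> exact_mod_cast key

end FiniteField

/-! ### Reduction modulo the maximal ideal -/

section Residue

variable {K : Type*} [NontriviallyNormedField K] [IsUltrametricDist K]

variable (K) in
/-- The ring of integers. -/
abbrev Integers : ValuationSubring K := (NormedField.valuation (K := K)).valuationSubring

variable (K) in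
/-- The residue field. -/
abbrev Residue : Type _ := IsLocalRing.ResidueField (Integers K)

theorem mem_integers {x : K} : x ∈ Integers K ↔ ‖x‖ ≤ 1 := by
  rw [Valuation.mem_valuationSubring_iff, NormedField.valuation_apply]
  exact Iff.rfl

open Classical in
/-- Reduction of integral elements, extended by zero. -/
def red (x : K) : Residue K :=
  if h : x ∈ Integers K then IsLocalRing.residue _ ⟨x, h⟩ else 0

theorem red_coe (x : Integers K) : red (x : K) = IsLocalRing.residue _ x := by
  rw [red, dif_pos x.2]

theorem lift_integers {x : K} (hx : ‖x‖ ≤ 1) : ∃ y : Integers K, (y : K) = x :=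
  ⟨⟨x, mem_integers.2 hx⟩, rfl⟩

theorem lift_integers_vec {ι : Type*} {v : ι → K} (hv : ∀ i, ‖v i‖ ≤ 1) :
    ∃ w : ι → Integers K, v = fun i => (w i : K) :=
  ⟨fun i => ⟨v i, mem_integers.2 (hv i)⟩, rfl⟩

theorem norm_coe_le (x : Integers K) : ‖(x : K)‖ ≤ 1 := mem_integers.1 x.2

theorem red_add {x y : K} (hx : ‖x‖ ≤ 1) (hy : ‖y‖ ≤ 1) : red (x + y) = red x + red y := by
  obtain ⟨x, rfl⟩ := lift_integers hx
  obtain ⟨y, rfl⟩ := lift_integers hy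
  rw [red_coe, red_coe, ← map_add, ← red_coe]; rfl

theorem red_mul {x y : K} (hx : ‖x‖ ≤ 1) (hy : ‖y‖ ≤ 1) : red (x * y) = red x * red y := by
  obtain ⟨x, rfl⟩ := lift_integers hx
  obtain ⟨y, rfl⟩ := lift_integers hy
  rw [red_coe, red_coe, ← map_mul, ← red_coe]; rfl

theorem red_sub {x y : K} (hx : ‖x‖ ≤ 1) (hy : ‖y‖ ≤ 1) : red (x - y) = red x - red y := by
  obtain ⟨x, rfl⟩ := lift_integers hx
  obtain ⟨y, rfl⟩ := lift_integers hy
  rw [red_coe, red_coe, ← map_sub, ← red_coe]; rfl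

theorem red_one : red (1 : K) = 1 := by
  rw [← map_one (IsLocalRing.residue (Integers K)), ← red_coe]; rfl

theorem red_zero : red (0 : K) = 0 := by
  rw [← map_zero (IsLocalRing.residue (Integers K)), ← red_coe]; rfl

theorem red_surjective (a : Residue K) : ∃ x : K, ‖x‖ ≤ 1 ∧ red x = a := by
  obtain ⟨x, hx⟩ := IsLocalRing.residue_surjective a
  exact ⟨x, norm_coe_le x, by rw [red_coe, hx]⟩

theorem red_eq_zero_iff {x : K} (hx : ‖x‖ ≤ 1) : red x = 0 ↔ ‖x‖ < 1 := by
  obtain ⟨x, rfl⟩ := lift_integers hx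
  rw [red_coe, IsLocalRing.residue_eq_zero_iff, IsLocalRing.mem_maximalIdeal, mem_nonunits_iff]
  rw [← not_iff_not, not_not, not_lt]
  constructor
  · rintro ⟨u, rfl⟩
    have h1 : ‖((u : Integers K) : K)‖ * ‖((u⁻¹ : (Integers K)ˣ) : K)‖ = 1 := by
      rw [← norm_mul, ← norm_one (α := K)]
      congr 1
      exact_mod_cast congrArg (Subtype.val) u.mul_inv
    have h2 := norm_coe_le (u⁻¹ : (Integers K)ˣ).1
    nlinarith [norm_nonneg ((u : Integers K) : K)]
  · intro h
    have h0 : (x : K) ≠ 0 := by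
      intro h0; rw [h0, norm_zero] at h; linarith
    have h1 : ‖(x : K)⁻¹‖ ≤ 1 := by rw [norm_inv]; exact inv_le_one_of_one_le₀ h
    exact IsUnit.of_mul_eq_one ⟨(x : K)⁻¹, mem_integers.2 h1⟩ (Subtype.ext (mul_inv_cancel₀ h0))

theorem red_eq_iff {x y : K} (hx : ‖x‖ ≤ 1) (hy : ‖y‖ ≤ 1) : red x = red y ↔ ‖x - y‖ < 1 := by
  have : ‖x - y‖ ≤ 1 := by
    rw [sub_eq_add_neg]
    exact (IsUltrametricDist.norm_add_le_max _ _).trans (max_le hx (by rwa [norm_neg]))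
  rw [← red_eq_zero_iff this, red_sub hx hy, sub_eq_zero]

variable {ι : Type*} [Fintype ι]

theorem red_dotProduct_mulVec {B : Matrix ι ι K} (hB : ∀ i j, ‖B i j‖ ≤ 1) {v w : ι → K}
    (hv : ∀ i, ‖v i‖ ≤ 1) (hw : ∀ i, ‖w i‖ ≤ 1) :
    red (v ⬝ᵥ B *ᵥ w) = (red ∘ v) ⬝ᵥ (B.map red) *ᵥ (red ∘ w) := by
  obtain ⟨v, rfl⟩ := lift_integers_vec hv
  obtain ⟨w, rfl⟩ := lift_integers_vec hw
  let B' : Matrix ι ι (Integers K) := fun i j => ⟨B i j, mem_integers.2 (hB i j)⟩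
  have h : (fun i => (v i : K)) ⬝ᵥ B *ᵥ (fun i => (w i : K)) =
      ((v ⬝ᵥ B' *ᵥ w : Integers K) : K) := by
    simp [dotProduct, Matrix.mulVec, B']
  rw [h, red_coe]
  simp only [dotProduct, Matrix.mulVec, map_sum, map_mul, ← red_coe]
  rfl

theorem red_mulVec {B : Matrix ι ι K} (hB : ∀ i j, ‖B i j‖ ≤ 1) {v : ι → K}
    (hv : ∀ i, ‖v i‖ ≤ 1) : red ∘ (B *ᵥ v) = (B.map red) *ᵥ (red ∘ v) := by
  obtain ⟨v, rfl⟩ := lift_integers_vec hv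
  let B' : Matrix ι ι (Integers K) := fun i j => ⟨B i j, mem_integers.2 (hB i j)⟩
  funext i
  have h : (B *ᵥ (fun i => (v i : K))) i = ((B' *ᵥ v) i : Integers K) := by
    simp [dotProduct, Matrix.mulVec, B']
  rw [Function.comp_apply, h, red_coe]
  simp only [dotProduct, Matrix.mulVec, map_sum, map_mul, ← red_coe]
  rfl

theorem red_det [DecidableEq ι] {B : Matrix ι ι K} (hB : ∀ i j, ‖B i j‖ ≤ 1) : red B.det = (B.map red).det := by
  let B' : Matrix ι ι (Integers K) := fun i j => ⟨B i j, mem_integers.2 (hB i j)⟩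
  have h : B.det = (B'.det : Integers K) := by
    have := RingHom.map_det (Integers K).subtype B'
    rw [show ((B'.det : Integers K) : K) = (Integers K).subtype B'.det from rfl, this]
    rfl
  rw [h, red_coe, RingHom.map_det]
  congr 1
  ext i j
  exact (red_coe (B' i j)).symm

end Residue

/-! ### The value group, and square roots by Hensel's lemma -/

section Uniformizer

variable {K : Type*} [NontriviallyNormedField K] [IsUltrametricDist K]

/-- An infinite residue field has `Nat.card` equal to $0$, so the normalization would make
$0^{-1}=0$ the largest norm below $1$, against nontriviality of the norm. Finiteness of the residue
field thus comes from `IsNormalizedAbs`. -/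
theorem residueCard_ne_zero (hK : IsNormalizedAbs K) : residueCard K ≠ 0 := by
  intro h0
  obtain ⟨⟨x, hx, hx1⟩, -⟩ := id hK
  obtain ⟨y, hy0, hy1⟩ := NormedField.exists_norm_lt_one K
  have := hK.2 ⟨y, rfl, hy1⟩
  rw [h0] at this
  simp at this
  exact hy0.ne' (by simpa using this)

theorem finite_residue (hK : IsNormalizedAbs K) : Finite (Residue K) :=
  Nat.finite_of_card_ne_zero (residueCard_ne_zero hK)

theorem one_lt_residueCard (hK : IsNormalizedAbs K) : 1 < residueCard K :=
  have := finite_residue hK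
  Finite.one_lt_card

theorem one_lt_residueCard_real (hK : IsNormalizedAbs K) : (1 : ℝ) < residueCard K := by
  exact_mod_cast one_lt_residueCard hK

theorem exists_uniformizer (hK : IsNormalizedAbs K) : ∃ p : K, ‖p‖ = (residueCard K : ℝ)⁻¹ := by
  obtain ⟨⟨x, hx, hx1⟩, -⟩ := id hK
  exact ⟨x, hx⟩

theorem norm_le_of_lt_one (hK : IsNormalizedAbs K) {x : K} (hx : ‖x‖ < 1) :
    ‖x‖ ≤ (residueCard K : ℝ)⁻¹ := hK.2 ⟨x, rfl, hx⟩

theorem norm_eq_zpow (hK : IsNormalizedAbs K) {x : K} (hx : x ≠ 0) :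
    ∃ m : ℤ, ‖x‖ = (residueCard K : ℝ) ^ m := by
  have hq := one_lt_residueCard_real hK
  have hq0 : (0 : ℝ) < residueCard K := by linarith
  obtain ⟨m, hm1, hm2⟩ := exists_mem_Ico_zpow (norm_pos_iff.2 hx) hq
  obtain ⟨p, hp⟩ := exists_uniformizer hK
  -- With $q^m\le\|x\|<q^{m+1}$, rescaling brings $x$ below norm $1$; the gap between $q^{-1}$ and
  -- $1$ then forces $\|x\|\le q^m$.
  have h1 : ‖x * p ^ (m + 1)‖ < 1 := by
    rw [norm_mul, norm_zpow, hp, inv_zpow, ← div_eq_mul_inv, div_lt_one (by positivity)]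
    exact hm2
  have h2 := norm_le_of_lt_one hK h1
  rw [norm_mul, norm_zpow, hp, inv_zpow, ← div_eq_mul_inv, div_le_iff₀ (by positivity),
    zpow_add_one₀ hq0.ne', ← mul_assoc, mul_comm (_⁻¹), mul_assoc, inv_mul_cancel₀ hq0.ne',
    mul_one] at h2
  exact ⟨m, le_antisymm h2 hm1⟩

theorem ringChar_residue_ne_two (h2 : ‖(2 : K)‖ = 1) : ringChar (Residue K) ≠ 2 := by
  intro h
  have h3 : red (2 : K) = 0 := by
    have h4 : red (2 : K) = ((2 : ℕ) : Residue K) := by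
      rw [show (2 : K) = 1 + 1 by norm_num, red_add (by simp) (by simp), red_one]
      push_cast; norm_num
    rw [h4, ringChar.spec, h]
  rw [red_eq_zero_iff h2.le, h2] at h3
  exact lt_irrefl _ h3

theorem norm_eq_one_of_sub_lt {x y : K} (hy : ‖y‖ = 1) (h : ‖x - y‖ < 1) : ‖x‖ = 1 := by
  have : ‖x - y‖ ≠ ‖y‖ := by rw [hy]; exact h.ne
  have := IsUltrametricDist.norm_add_eq_max_of_norm_ne_norm this
  rw [sub_add_cancel, hy, max_eq_right h.le] at this
  exact this

theorem exists_sqrt_of_norm_sub_one_lt [CompleteSpace K] (h2 : ‖(2 : K)‖ = 1) {u : K}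
    (hu : ‖u - 1‖ < 1) : ∃ s : K, ‖s - 1‖ < 1 ∧ s ^ 2 = u := by
  have h20 : (2 : K) ≠ 0 := by intro h; rw [h, norm_zero] at h2; norm_num at h2
  set r : NNReal := ‖u - 1‖₊ with hr
  have hr1 : (r : ℝ) < 1 := hu
  -- With $s=1+z$, the equation $s^2=u$ reads $z=(u-1-z^2)/2$. As $2$ is a unit, this map contracts
  -- the closed ball of radius $\|u-1\|<1$.
  let T : K → K := fun z => (u - 1 - z ^ 2) / 2
  have hT : ∀ z, ‖T z‖ = ‖u - 1 - z ^ 2‖ := fun z => by simp [T, h2]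
  have hmaps : Set.MapsTo T (Metric.closedBall 0 r) (Metric.closedBall 0 r) := by
    intro z hz
    rw [mem_closedBall_zero_iff] at hz ⊢
    rw [hT, sub_eq_add_neg]
    refine (IsUltrametricDist.norm_add_le_max _ _).trans (max_le le_rfl ?_)
    rw [norm_neg, norm_pow]
    nlinarith [norm_nonneg z]
  have hcontr : ContractingWith r (hmaps.restrict T _ _) := by
    refine ⟨hr1, LipschitzWith.of_dist_le_mul fun z w => ?_⟩
    rw [Subtype.dist_eq, Subtype.dist_eq, dist_eq_norm, dist_eq_norm]
    have hz := mem_closedBall_zero_iff.1 z.2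
    have hw := mem_closedBall_zero_iff.1 w.2
    have : T z - T w = (-(z + w : K)) * ((z : K) - w) / 2 := by simp only [T]; ring
    change ‖T z - T w‖ ≤ _
    rw [this, norm_div, h2, div_one, norm_mul, norm_neg]
    gcongr
    exact (IsUltrametricDist.norm_add_le_max _ _).trans (max_le hz hw)
  obtain ⟨z, hz, hfix, -⟩ := hcontr.exists_fixedPoint' (x := (0 : K))
    Metric.isClosed_closedBall.isComplete hmaps (by simp) (edist_ne_top _ _)
  refine ⟨1 + z, ?_, ?_⟩
  · rw [add_sub_cancel_left]
    exact (mem_closedBall_zero_iff.1 hz).trans_lt hr1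
  · have : (u - 1 - z ^ 2) / 2 = z := hfix
    field_simp at this
    linear_combination -this

/-- The factor $s+t$ is congruent to the unit $2$. Hence square roots in $1+\mathfrak p$ are unique
and depend isometrically on their squares. -/
theorem norm_sub_eq_norm_sq_sub (h2 : ‖(2 : K)‖ = 1) {s t : K} (hs : ‖s - 1‖ < 1)
    (ht : ‖t - 1‖ < 1) : ‖s - t‖ = ‖s ^ 2 - t ^ 2‖ := by
  have : ‖s + t‖ = 1 := by
    refine norm_eq_one_of_sub_lt h2 ?_
    rw [show s + t - 2 = (s - 1) + (t - 1) by ring]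
    exact (IsUltrametricDist.norm_add_le_max _ _).trans_lt (max_lt hs ht)
  rw [sq_sub_sq, norm_mul, this, one_mul]

/-- A square root modulo $\mathfrak p$ lifts because the quotient $u/y^2$ lies in $1+\mathfrak p$,
where every element is a square. -/
theorem quadChar_eq_quadraticChar_red [CompleteSpace K] [Fintype (Residue K)]
    [DecidableEq (Residue K)] (h2 : ‖(2 : K)‖ = 1) {u : K} (hu : ‖u‖ = 1) :
    quadChar u = quadraticChar (Residue K) (red u) := by
  have hr0 : red u ≠ 0 := by
    rw [Ne, red_eq_zero_iff hu.le, hu]; exact lt_irrefl _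
  have hiff : IsSquare u ↔ IsSquare (red u) := by
    constructor
    · rintro ⟨y, rfl⟩
      have hy : ‖y‖ ≤ 1 := by
        rw [norm_mul] at hu
        nlinarith [norm_nonneg y]
      exact ⟨red y, red_mul hy hy⟩
    · rintro ⟨b, hb⟩
      obtain ⟨y, hy, rfl⟩ := red_surjective b
      rw [← red_mul hy hy, red_eq_iff hu.le (by rw [norm_mul]; nlinarith [norm_nonneg y])] at hb
      have hyy : ‖y * y‖ = 1 := norm_eq_one_of_sub_lt hu (by rwa [norm_sub_rev])
      have hyy0 : y * y ≠ 0 := by intro h; rw [h, norm_zero] at hyy; norm_num at hyy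
      obtain ⟨s, -, hs⟩ := exists_sqrt_of_norm_sub_one_lt h2 (u := u / (y * y)) (by
        rw [show u / (y * y) - 1 = (u - y * y) / (y * y) by rw [sub_div, div_self hyy0], norm_div, hyy, div_one]
        exact hb)
      refine ⟨s * y, ?_⟩
      rw [eq_div_iff hyy0] at hs
      rw [← hs]; ring
  rw [quadChar]
  split_ifs with h
  · exact ((quadraticChar_one_iff_isSquare hr0).2 (hiff.1 h)).symm
  · exact (quadraticChar_neg_one_iff_not_isSquare.2 (fun h' => h (hiff.2 h'))).symm

end Uniformizer

/-! ### Quadratic forms given by Gram matrices, and ultrametric bounds -/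

section QuadraticForm

variable {R : Type*} [CommRing R] {ι : Type*} [Fintype ι]

/-- The quadratic form with Gram matrix `B`. -/
def qf (B : Matrix ι ι R) (v : ι → R) : R := v ⬝ᵥ B *ᵥ v

theorem dotProduct_mulVec_comm {B : Matrix ι ι R} (hB : B.IsSymm) (v w : ι → R) :
    v ⬝ᵥ B *ᵥ w = w ⬝ᵥ B *ᵥ v := by
  rw [Matrix.dotProduct_mulVec, ← Matrix.mulVec_transpose, hB.eq, dotProduct_comm]

theorem qf_add {B : Matrix ι ι R} (hB : B.IsSymm) (v w : ι → R) :
    qf B (v + w) = qf B v + 2 * (v ⬝ᵥ B *ᵥ w) + qf B w := by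
  simp only [qf, Matrix.mulVec_add, dotProduct_add, add_dotProduct]
  rw [dotProduct_mulVec_comm hB w v]; ring

theorem qf_smul (B : Matrix ι ι R) (t : R) (v : ι → R) : qf B (t • v) = t ^ 2 * qf B v := by
  simp only [qf, Matrix.mulVec_smul, dotProduct_smul, smul_dotProduct, smul_eq_mul]; ring

variable {K : Type*} [NontriviallyNormedField K]

theorem continuous_qf (B : Matrix ι ι K) : Continuous (qf B) := by
  unfold qf
  exact continuous_id.dotProduct (continuous_const.matrix_mulVec continuous_id)

variable [IsUltrametricDist K]

theorem norm_dotProduct_le (v w : ι → K) : ‖v ⬝ᵥ w‖ ≤ ‖v‖ * ‖w‖ := by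
  refine IsUltrametricDist.norm_sum_le_of_forall_le_of_nonneg (by positivity) fun i _ => ?_
  rw [norm_mul]
  exact mul_le_mul (norm_le_pi_norm v i) (norm_le_pi_norm w i) (norm_nonneg _) (norm_nonneg _)

theorem norm_mulVec_le {B : Matrix ι ι K} (hB : ∀ i j, ‖B i j‖ ≤ 1) (w : ι → K) :
    ‖B *ᵥ w‖ ≤ ‖w‖ := by
  refine (pi_norm_le_iff_of_nonneg (norm_nonneg _)).2 fun i => ?_
  refine (norm_dotProduct_le _ _).trans ?_
  have : ‖B i‖ ≤ 1 := (pi_norm_le_iff_of_nonneg zero_le_one).2 (hB i)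
  nlinarith [norm_nonneg w]

theorem norm_dotProduct_mulVec_le {B : Matrix ι ι K} (hB : ∀ i j, ‖B i j‖ ≤ 1) (v w : ι → K) :
    ‖v ⬝ᵥ B *ᵥ w‖ ≤ ‖v‖ * ‖w‖ :=
  (norm_dotProduct_le _ _).trans
    (mul_le_mul_of_nonneg_left (norm_mulVec_le hB w) (norm_nonneg _))

theorem norm_qf_le {B : Matrix ι ι K} (hB : ∀ i j, ‖B i j‖ ≤ 1) (v : ι → K) :
    ‖qf B v‖ ≤ ‖v‖ ^ 2 := by
  rw [sq]; exact norm_dotProduct_mulVec_le hB v v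

end QuadraticForm

/-! ### Volumes of level sets of an integral unimodular form -/

section Volume

set_option linter.unusedSectionVars false

variable {K : Type*} [NontriviallyNormedField K] [IsUltrametricDist K]
  {ι : Type*} [Fintype ι]

/-- The integral vectors with a given reduction. -/
def residueClass (a : ι → Residue K) : Set (ι → K) := {v | ‖v‖ ≤ 1 ∧ red ∘ v = a}

/-- Residue classes are the cosets of $\mathfrak p^\iota$ in $\mathfrak o^\iota$, which for the sup
norm are open balls of radius $1$; so all have the same volume. -/
theorem residueClass_eq_ball (a : ι → Residue K) :
    ∃ w : ι → K, ‖w‖ ≤ 1 ∧ residueClass a = Metric.ball w 1 := by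
  choose w hw hwa using fun i => red_surjective (a i)
  have hw1 : ‖w‖ ≤ 1 := (pi_norm_le_iff_of_nonneg zero_le_one).2 hw
  refine ⟨w, hw1, ?_⟩
  ext v
  rw [mem_ball_iff_norm, pi_norm_lt_iff one_pos]
  constructor
  · rintro ⟨hv, hva⟩ i
    rw [Pi.sub_apply, ← red_eq_iff ((norm_le_pi_norm v i).trans hv) (hw i), hwa, ← hva]; rfl
  · intro h
    have hv : ∀ i, ‖v i‖ ≤ 1 := fun i => by
      have := IsUltrametricDist.norm_add_le_max (v i - w i) (w i)
      rw [sub_add_cancel] at this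
      exact this.trans (max_le (h i).le (hw i))
    refine ⟨(pi_norm_le_iff_of_nonneg zero_le_one).2 hv, funext fun i => ?_⟩
    rw [← hwa, Function.comp_apply, red_eq_iff (hv i) (hw i)]
    exact h i

theorem add_mem_residueClass_iff {a : ι → Residue K} {g : ι → K} (hg : ‖g‖ < 1) (w : ι → K) :
    g + w ∈ residueClass a ↔ w ∈ residueClass a := by
  obtain ⟨v, -, hv⟩ := residueClass_eq_ball a
  rw [hv, mem_ball_iff_norm, mem_ball_iff_norm]
  have key : ∀ x y : ι → K, ‖x‖ < 1 → ‖y‖ < 1 → ‖x + y‖ < 1 := fun x y hx hy =>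
    (IsUltrametricDist.norm_add_le_max x y).trans_lt (max_lt hx hy)
  constructor
  · intro h
    have := key _ _ h (by rwa [norm_neg] : ‖-g‖ < 1)
    rwa [show g + w - v + -g = w - v by abel] at this
  · intro h
    rw [add_sub_assoc]
    exact key _ _ hg h

theorem pairwise_disjoint_residueClass :
    Pairwise (Function.onFun Disjoint (residueClass (K := K) (ι := ι))) := by
  intro a b hab
  refine Set.disjoint_left.2 fun v hv hv' => hab ?_
  rw [← hv.2, ← hv'.2]

theorem norm_lt_one_of_red_eq_zero {v : ι → K} (hv : ‖v‖ ≤ 1) (h : red ∘ v = 0) : ‖v‖ < 1 := by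
  rw [pi_norm_lt_iff one_pos]
  intro i
  rw [← red_eq_zero_iff ((norm_le_pi_norm v i).trans hv)]
  exact congrFun h i

theorem norm_eq_one_iff_red_ne_zero {v : ι → K} (hv : ‖v‖ ≤ 1) : ‖v‖ = 1 ↔ red ∘ v ≠ 0 := by
  constructor
  · intro h h0
    exact (norm_lt_one_of_red_eq_zero hv h0).ne h
  · intro h
    refine le_antisymm hv (not_lt.1 fun hlt => h (funext fun i => ?_))
    rw [Function.comp_apply, Pi.zero_apply, red_eq_zero_iff ((norm_le_pi_norm v i).trans hv)]
    exact (norm_le_pi_norm v i).trans_lt hlt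

theorem red_qf {B : Matrix ι ι K} (hB : ∀ i j, ‖B i j‖ ≤ 1) {a : ι → Residue K} {v : ι → K}
    (hv : v ∈ residueClass a) : red (qf B v) = qf (B.map red) a := by
  have h : ∀ i, ‖v i‖ ≤ 1 := fun i => (norm_le_pi_norm v i).trans hv.1
  rw [qf, red_dotProduct_mulVec hB h h, hv.2]; rfl

variable [ProperSpace K] [MeasurableSpace K] [BorelSpace K]

theorem measurableSet_residueClass (a : ι → Residue K) :
    MeasurableSet (residueClass a) := by
  obtain ⟨w, -, hw⟩ := residueClass_eq_ball a
  rw [hw]; exact measurableSet_ball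

variable (vol : Measure (ι → K)) [vol.IsAddHaarMeasure]

theorem measure_residueClass (a : ι → Residue K) :
    vol (residueClass a) = vol (Metric.ball 0 1) := by
  obtain ⟨w, -, hw⟩ := residueClass_eq_ball a
  rw [hw]
  have := measure_preimage_add vol w (Metric.ball w 1)
  rw [← this]
  congr 1
  ext v
  simp

theorem measure_reduction_mem [Fintype (Residue K)] (A : Finset (ι → Residue K)) :
    vol {v | ‖v‖ ≤ 1 ∧ red ∘ v ∈ A} = A.card * vol (Metric.ball 0 1) := by
  have : {v : ι → K | ‖v‖ ≤ 1 ∧ red ∘ v ∈ A} = ⋃ a ∈ A, residueClass a := by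
    ext v
    simp [residueClass]
  rw [this, measure_biUnion_finset]
  · simp [measure_residueClass]
  · exact fun a _ b _ hab => pairwise_disjoint_residueClass hab
  · exact fun a _ => measurableSet_residueClass a

theorem exists_map_linearEquiv_eq_smul (L : (ι → K) ≃L[K] (ι → K)) :
    ∃ c : NNReal, vol.map L = c • vol := by
  have := L.isAddHaarMeasure_map vol
  exact ⟨_, Measure.isAddLeftInvariant_eq_smul (vol.map L) vol⟩

theorem measure_ball_ne_zero : vol (Metric.ball 0 1) ≠ 0 :=
  (Metric.isOpen_ball.measure_pos vol ⟨0, by simp⟩).ne'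

theorem measure_ball_ne_top : vol (Metric.ball 0 1) ≠ ⊤ :=
  ((measure_mono Metric.ball_subset_closedBall).trans_lt
    (isCompact_closedBall (0 : ι → K) 1).measure_lt_top).ne

/-- Haar measure scales by some constant. It is found on the open unit ball, whose preimage is the
closed unit ball, a union of $q^{|\iota|}$ residue classes. -/
theorem measure_preimage_uniformizer_smul [Fintype (Residue K)] [DecidableEq ι]
    (hK : IsNormalizedAbs K)
    {p : K} (hp : ‖p‖ = (residueCard K : ℝ)⁻¹) {A : Set (ι → K)} (hA : MeasurableSet A) :
    vol ((fun v => p • v) ⁻¹' A) = (residueCard K : ENNReal) ^ Fintype.card ι * vol A := by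
  have hq := one_lt_residueCard_real hK
  have hp0 : p ≠ 0 := by
    intro h
    rw [h, norm_zero] at hp
    have : (0 : ℝ) < (residueCard K : ℝ)⁻¹ := by positivity
    linarith
  let L : (ι → K) ≃L[K] (ι → K) := ContinuousLinearEquiv.smulLeft (Units.mk0 p hp0)
  obtain ⟨c, hc⟩ := exists_map_linearEquiv_eq_smul vol L
  have hL : ∀ A : Set (ι → K), MeasurableSet A → vol ((fun v => p • v) ⁻¹' A) = c * vol A := by
    intro A hA
    have : vol.map L A = (c • vol) A := by rw [hc]
    rw [Measure.map_apply L.continuous.measurable hA] at this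
    exact this
  have h1 := hL (Metric.ball 0 1) measurableSet_ball
  have h2 : (fun v : ι → K => p • v) ⁻¹' (Metric.ball 0 1) =
      {v | ‖v‖ ≤ 1 ∧ red ∘ v ∈ (Finset.univ : Finset (ι → Residue K))} := by
    ext v
    simp only [Set.mem_preimage, mem_ball_zero_iff, Finset.mem_univ, and_true, Set.mem_ofPred_eq,
      norm_smul, hp]
    constructor
    · intro h
      refine (pi_norm_le_iff_of_nonneg zero_le_one).2 fun i => ?_
      by_contra hi
      push Not at hi
      have h3 : ‖(v i)⁻¹‖ < 1 := by rw [norm_inv]; exact inv_lt_one_of_one_lt₀ hi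
      have h4 := norm_le_of_lt_one hK h3
      rw [norm_inv, inv_le_inv₀ (by linarith) (by linarith)] at h4
      have h5 := h4.trans (norm_le_pi_norm v i)
      rw [inv_mul_lt_iff₀ (by linarith)] at h
      linarith
    · intro h
      rw [inv_mul_lt_iff₀ (by linarith)]
      linarith
  rw [h2, measure_reduction_mem, Finset.card_univ, Fintype.card_fun] at h1
  have h3 := (ENNReal.mul_left_inj (measure_ball_ne_zero vol) (measure_ball_ne_top vol)).1 h1
  rw [hL A hA, ← h3, ← Nat.card_eq_fintype_card]
  push_cast
  rfl

theorem measure_preimage_pow_smul [Fintype (Residue K)] [DecidableEq ι]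
    (hK : IsNormalizedAbs K)
    {p : K} (hp : ‖p‖ = (residueCard K : ℝ)⁻¹) (m : ℕ) {A : Set (ι → K)} (hA : MeasurableSet A) :
    vol ((fun v => p ^ m • v) ⁻¹' A) =
      (residueCard K : ENNReal) ^ (m * Fintype.card ι) * vol A := by
  induction m with
  | zero => simp
  | succ m ih =>
    have h : (fun v : ι → K => p ^ (m + 1) • v) ⁻¹' A =
        (fun v => p • v) ⁻¹' ((fun v => p ^ m • v) ⁻¹' A) := by
      ext v
      simp [smul_smul, pow_succ]
    rw [h, measure_preimage_uniformizer_smul vol hK hp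
      ((measurable_const_smul (p ^ m)) hA), ih]
    ring

/-- The part of a residue class where the quadratic form is close to `c`. -/
def nearClass (B : Matrix ι ι K) (p : K) (a : ι → Residue K) (c : K) (j : ℕ) : Set (ι → K) :=
  {w | w ∈ residueClass a ∧ ‖(qf B w - c) / p ^ j‖ ≤ 1}

theorem measurableSet_nearClass (B : Matrix ι ι K) (p : K) (a : ι → Residue K) (c : K) (j : ℕ) :
    MeasurableSet (nearClass B p a c j) := by
  refine (measurableSet_residueClass a).inter ?_
  exact (isClosed_le (((continuous_qf B).sub continuous_const).div_const _).norm
    continuous_const).measurableSet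

/-- Measure-theoretic Hensel lemma. The gradient $2Ba$ is nonzero in the residue field, so
translations of size $\|p^j\|$ permute the $q$ possible next digits of $\mathrm{qf}(w)-c$, and these
are equidistributed. -/
theorem measure_nearClass_succ [Fintype (Residue K)] [DecidableEq ι]
    (hK : IsNormalizedAbs K) (h2 : ‖(2 : K)‖ = 1)
    {p : K} (hp : ‖p‖ = (residueCard K : ℝ)⁻¹)
    {B : Matrix ι ι K} (hBs : B.IsSymm) (hB : ∀ i j, ‖B i j‖ ≤ 1) {a : ι → Residue K}
    (ha : B.map red *ᵥ a ≠ 0) (c : K) {j : ℕ} (hj : 1 ≤ j) :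
    vol (nearClass B p a c j) = (residueCard K : ENNReal) * vol (nearClass B p a c (j + 1)) := by
  classical
  have hq := one_lt_residueCard_real hK
  have hp1 : ‖p‖ < 1 := by rw [hp]; exact inv_lt_one_of_one_lt₀ hq
  have hpp : 0 < ‖p‖ := by rw [hp]; positivity
  have hp0 : p ≠ 0 := norm_pos_iff.1 hpp
  have hpj : ‖p ^ j‖ < 1 := by rw [norm_pow]; exact pow_lt_one₀ (norm_nonneg _) hp1 (by omega)
  have hpj0 : p ^ j ≠ 0 := pow_ne_zero _ hp0
  obtain ⟨i, hi⟩ := Function.ne_iff.1 ha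
  rw [Pi.zero_apply] at hi
  -- The $i$-th partial derivative of the form at $a$; the index was chosen so that it does not
  -- vanish.
  set u : Residue K := red 2 * (B.map red *ᵥ a) i with hu
  have hu0 : u ≠ 0 := by
    refine mul_ne_zero ?_ hi
    rw [Ne, red_eq_zero_iff h2.le, h2]; exact lt_irrefl _
  let U : Residue K → Set (ι → K) := fun β =>
    {w | w ∈ nearClass B p a c j ∧ red ((qf B w - c) / p ^ j) = β}
  have hU0 : U 0 = nearClass B p a c (j + 1) := by
    ext w
    have hdiv : (qf B w - c) / p ^ (j + 1) = ((qf B w - c) / p ^ j) / p := by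
      rw [div_div, pow_succ]
    simp only [U, nearClass, Set.mem_ofPred_eq, and_assoc]
    refine and_congr_right fun _ => ?_
    rw [hdiv, norm_div _ p, div_le_one hpp, hp]
    constructor
    · rintro ⟨h1, h3⟩
      rw [red_eq_zero_iff h1] at h3
      exact norm_le_of_lt_one hK h3
    · intro h
      rw [← hp] at h
      exact ⟨(h.trans hp1.le), (red_eq_zero_iff (h.trans hp1.le)).2 (h.trans_lt hp1)⟩
  have hUβ : ∀ β, vol (U β) = vol (nearClass B p a c (j + 1)) := by
    intro β
    obtain ⟨l, hl, hlβ⟩ := red_surjective (β / u)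
    -- This translation changes $(\mathrm{qf}(w)-c)/p^j$ by $2l(Bw)_i+p^jl^2B_{ii}$. The first term
    -- reduces to $\beta$ by the choice of $l$, and the second reduces to $0$ since $j\ge1$.
    let g : ι → K := (p ^ j * l) • Pi.single i 1
    have hg : ‖g‖ < 1 := by
      rw [norm_smul, norm_mul, Pi.norm_single, norm_one, mul_one]
      nlinarith [norm_nonneg l, norm_nonneg (p ^ j)]
    rw [← hU0, ← measure_preimage_add vol g (U β)]
    congr 1
    ext w
    simp only [U, nearClass, Set.mem_ofPred_eq, and_assoc, Set.mem_preimage]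
    rw [add_mem_residueClass_iff hg]
    refine and_congr_right fun hw => ?_
    have hwi : ∀ k, ‖w k‖ ≤ 1 := fun k => (norm_le_pi_norm w k).trans hw.1
    have hBw : ‖(B *ᵥ w) i‖ ≤ 1 :=
      (norm_le_pi_norm _ i).trans ((norm_mulVec_le hB w).trans hw.1)
    let y : K := l * (2 * (B *ᵥ w) i) + p ^ j * (l ^ 2 * B i i)
    have h2B : ‖2 * (B *ᵥ w) i‖ ≤ 1 := by rw [norm_mul, h2, one_mul]; exact hBw
    have hy1 : ‖l * (2 * (B *ᵥ w) i)‖ ≤ 1 := by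
      rw [norm_mul]; exact mul_le_one₀ hl (norm_nonneg _) h2B
    have hy2' : ‖l ^ 2 * B i i‖ ≤ 1 := by
      rw [norm_mul, norm_pow]
      exact mul_le_one₀ (pow_le_one₀ (norm_nonneg _) hl) (norm_nonneg _) (hB i i)
    have hy2 : ‖p ^ j * (l ^ 2 * B i i)‖ < 1 := by
      rw [norm_mul]
      nlinarith [norm_nonneg (l ^ 2 * B i i), norm_nonneg (p ^ j)]
    have hy : ‖y‖ ≤ 1 := (IsUltrametricDist.norm_add_le_max _ _).trans (max_le hy1 hy2.le)
    have hry : red y = β := by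
      have : red ((B *ᵥ w) i) = (B.map red *ᵥ a) i := by
        rw [← hw.2, ← red_mulVec hB hwi]; rfl
      rw [red_add hy1 hy2.le, (red_eq_zero_iff hy2.le).2 hy2, add_zero, red_mul hl h2B,
        red_mul h2.le hBw, hlβ, this]
      exact div_mul_cancel₀ β hu0
    have hx : (qf B (g + w) - c) / p ^ j = (qf B w - c) / p ^ j + y := by
      have h3 : w ⬝ᵥ B *ᵥ (Pi.single i 1) = (B *ᵥ w) i := by
        rw [dotProduct_mulVec_comm hBs, single_one_dotProduct]
      have h4 : qf B (Pi.single i 1) = B i i := by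
        simp [qf]
      rw [add_comm g w, qf_add hBs, qf_smul, Matrix.mulVec_smul, dotProduct_smul, h3, h4,
        smul_eq_mul]
      field_simp
      simp only [y]
      ring
    rw [hx]
    constructor
    · rintro ⟨h3, h4⟩
      have h5 : ‖(qf B w - c) / p ^ j‖ ≤ 1 := by
        have := IsUltrametricDist.norm_add_le_max ((qf B w - c) / p ^ j + y) (-y)
        rw [add_neg_cancel_right, norm_neg] at this
        exact this.trans (max_le h3 hy)
      refine ⟨h5, ?_⟩
      rw [red_add h5 hy, hry] at h4
      simpa using h4
    · rintro ⟨h3, h4⟩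
      refine ⟨(IsUltrametricDist.norm_add_le_max _ _).trans (max_le h3 hy), ?_⟩
      rw [red_add h3 hy, h4, hry, zero_add]
  have hcover : nearClass B p a c j = ⋃ β ∈ (Finset.univ : Finset (Residue K)), U β := by
    ext w; simp [U]
  have hmeas : ∀ β, MeasurableSet (U β) := by
    intro β
    obtain ⟨b, hb, rfl⟩ := red_surjective β
    have : U (red b) = nearClass B p a c j ∩ {w | ‖(qf B w - c) / p ^ j - b‖ < 1} := by
      ext w
      simp only [U, Set.mem_ofPred_eq, Set.mem_inter_iff]
      exact and_congr_right fun hw => red_eq_iff hw.2 hb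
    rw [this]
    refine (measurableSet_nearClass B p a c j).inter ?_
    exact (isOpen_lt ((((continuous_qf B).sub continuous_const).div_const _).sub
      continuous_const).norm continuous_const).measurableSet
  rw [hcover, measure_biUnion_finset]
  · simp only [hUβ, Finset.sum_const, Finset.card_univ, nsmul_eq_mul]
    rw [residueCard, Nat.card_eq_fintype_card]
  · intro β _ γ _ hβγ
    refine Set.disjoint_left.2 fun w hw hw' => hβγ ?_
    rw [← hw.2, ← hw'.2]
  · exact fun β _ => hmeas β

theorem measure_nearClass_add [Fintype (Residue K)] [DecidableEq ι]
    (hK : IsNormalizedAbs K) (h2 : ‖(2 : K)‖ = 1)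
    {p : K} (hp : ‖p‖ = (residueCard K : ℝ)⁻¹)
    {B : Matrix ι ι K} (hBs : B.IsSymm) (hB : ∀ i j, ‖B i j‖ ≤ 1) {a : ι → Residue K}
    (ha : B.map red *ᵥ a ≠ 0) (c : K) (k : ℕ) :
    (residueCard K : ENNReal) ^ k * vol (nearClass B p a c (k + 1)) =
      vol (nearClass B p a c 1) := by
  induction k with
  | zero => simp
  | succ k ih =>
    rw [← ih, measure_nearClass_succ vol hK h2 hp hBs hB ha c (j := k + 1) (by omega)]
    ring

/-- Unimodularity makes every nonzero class modulo $\mathfrak p$ a smooth point of the form, so each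
of the $k$ further digits of precision costs a factor $q$. At precision $\mathfrak p$ itself the
target $c$ reduces to $0$, leaving the nonzero isotropic classes. -/
theorem measure_near_level [Fintype (Residue K)] [DecidableEq (Residue K)] [DecidableEq ι]
    (hK : IsNormalizedAbs K) (h2 : ‖(2 : K)‖ = 1)
    {p : K} (hp : ‖p‖ = (residueCard K : ℝ)⁻¹)
    {B : Matrix ι ι K} (hBs : B.IsSymm) (hB : ∀ i j, ‖B i j‖ ≤ 1) (hdet : ‖B.det‖ = 1)
    {c : K} (hc : ‖c‖ < 1) (k : ℕ) :
    (residueCard K : ENNReal) ^ k * vol {w | ‖w‖ = 1 ∧ ‖(qf B w - c) / p ^ (k + 1)‖ ≤ 1} =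
      (Finset.univ.filter fun a : ι → Residue K => a ≠ 0 ∧ qf (B.map red) a = 0).card *
        vol (Metric.ball 0 1) := by
  have hq := one_lt_residueCard_real hK
  have hp1 : ‖p‖ < 1 := by rw [hp]; exact inv_lt_one_of_one_lt₀ hq
  have hpp : 0 < ‖p‖ := by rw [hp]; positivity
  have hdetr : IsUnit (B.map red).det := by
    rw [isUnit_iff_ne_zero, ← red_det hB, Ne, red_eq_zero_iff hdet.le, hdet]
    exact lt_irrefl _
  have hker : ∀ a : ι → Residue K, a ≠ 0 → B.map red *ᵥ a ≠ 0 := fun a ha h =>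
    ha (Matrix.eq_zero_of_mulVec_eq_zero hdetr.ne_zero h)
  have hcover : {w | ‖w‖ = 1 ∧ ‖(qf B w - c) / p ^ (k + 1)‖ ≤ 1} =
      ⋃ a ∈ (Finset.univ.filter fun a : ι → Residue K => a ≠ 0), nearClass B p a c (k + 1) := by
    ext w
    simp only [nearClass, residueClass, Set.mem_ofPred_eq, Finset.mem_filter, Finset.mem_univ,
      true_and, Set.mem_iUnion, exists_prop]
    constructor
    · rintro ⟨h1, h3⟩
      exact ⟨red ∘ w, (norm_eq_one_iff_red_ne_zero h1.le).1 h1, ⟨h1.le, rfl⟩, h3⟩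
    · rintro ⟨a, ha, ⟨h1, rfl⟩, h3⟩
      exact ⟨(norm_eq_one_iff_red_ne_zero h1).2 ha, h3⟩
  have hone : ∀ a : ι → Residue K, vol (nearClass B p a c 1) =
      if qf (B.map red) a = 0 then vol (Metric.ball 0 1) else 0 := by
    intro a
    have hw : ∀ w ∈ residueClass a, (‖(qf B w - c) / p ^ 1‖ ≤ 1 ↔ qf (B.map red) a = 0) := by
      intro w hw
      have hqw : ‖qf B w‖ ≤ 1 := (norm_qf_le hB w).trans (pow_le_one₀ (norm_nonneg _) hw.1)
      rw [← red_qf hB hw, ← (red_eq_zero_iff hc.le).2 hc, red_eq_iff hqw hc.le, pow_one, norm_div,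
        div_le_one hpp]
      exact ⟨fun h => h.trans_lt hp1, fun h => hp ▸ norm_le_of_lt_one hK h⟩
    split_ifs with h
    · rw [← measure_residueClass vol a]
      congr 1
      ext w
      exact ⟨fun h' => h'.1, fun h' => ⟨h', (hw w h').2 h⟩⟩
    · rw [← measure_empty (μ := vol)]
      congr 1
      refine Set.eq_empty_of_forall_notMem fun w hw' => h ((hw w hw'.1).1 hw'.2)
  rw [hcover, measure_biUnion_finset, Finset.mul_sum]
  · have : ∀ a ∈ (Finset.univ.filter fun a : ι → Residue K => a ≠ 0),
        (residueCard K : ENNReal) ^ k * vol (nearClass B p a c (k + 1)) =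
          if qf (B.map red) a = 0 then vol (Metric.ball 0 1) else 0 := by
      intro a ha
      rw [measure_nearClass_add vol hK h2 hp hBs hB (hker a (Finset.mem_filter.1 ha).2), hone]
    rw [Finset.sum_congr rfl this, ← Finset.sum_filter, Finset.filter_filter, Finset.sum_const,
      nsmul_eq_mul]
  · intro a _ b _ hab
    exact (pairwise_disjoint_residueClass hab).mono (fun w hw => hw.1) (fun w hw => hw.1)
  · exact fun a _ => measurableSet_nearClass B p a c _

theorem measure_level_zero [Fintype (Residue K)] [DecidableEq (Residue K)] [DecidableEq ι]
    {B : Matrix ι ι K} (hB : ∀ i j, ‖B i j‖ ≤ 1) :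
    vol {w | ‖qf B w - 1‖ < 1 ∧ ‖w‖ = 1} =
      (Finset.univ.filter fun a : ι → Residue K => qf (B.map red) a = 1).card *
        vol (Metric.ball 0 1) := by
  rw [← measure_reduction_mem]
  congr 1
  ext w
  simp only [Set.mem_ofPred_eq, Finset.mem_filter, Finset.mem_univ, true_and]
  have key : ‖w‖ ≤ 1 → (‖qf B w - 1‖ < 1 ↔ qf (B.map red) (red ∘ w) = 1) := by
    intro hw
    have hqw : ‖qf B w‖ ≤ 1 := (norm_qf_le hB w).trans (pow_le_one₀ (norm_nonneg _) hw)
    rw [← red_qf hB ⟨hw, rfl⟩, ← red_one, red_eq_iff hqw (by simp)]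
  constructor
  · rintro ⟨h1, h3⟩
    exact ⟨h3.le, (key h3.le).1 h1⟩
  · rintro ⟨h1, h3⟩
    refine ⟨(key h1).2 h3, (norm_eq_one_iff_red_ne_zero h1).2 fun h0 => ?_⟩
    rw [h0] at h3
    simp [qf] at h3

/-- Multiplication by $p^m$ moves the shell to norm $1$ and the condition $\mathrm{qf}\in1+\mathfrak
p$ to $\mathrm{qf}\equiv p^{2m}$ modulo $\mathfrak p^{2m+1}$. So `measure_near_level` applies with
$k=2m$; $m\ne0$ is what makes the target reduce to $0$. -/
theorem measure_level_succ [Fintype (Residue K)] [DecidableEq (Residue K)] [DecidableEq ι]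
    (hK : IsNormalizedAbs K) (h2 : ‖(2 : K)‖ = 1)
    {B : Matrix ι ι K} (hBs : B.IsSymm) (hB : ∀ i j, ‖B i j‖ ≤ 1) (hdet : ‖B.det‖ = 1)
    {m : ℕ} (hm : m ≠ 0) :
    (residueCard K : ENNReal) ^ (2 * m) *
        vol {w | ‖qf B w - 1‖ < 1 ∧ ‖w‖ = (residueCard K : ℝ) ^ m} =
      (residueCard K : ENNReal) ^ (m * Fintype.card ι) *
        ((Finset.univ.filter fun a : ι → Residue K => a ≠ 0 ∧ qf (B.map red) a = 0).card *
        vol (Metric.ball 0 1)) := by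
  obtain ⟨p, hp⟩ := exists_uniformizer hK
  have hq := one_lt_residueCard_real hK
  have hp1 : ‖p‖ < 1 := by rw [hp]; exact inv_lt_one_of_one_lt₀ hq
  have hpp : 0 < ‖p‖ := by rw [hp]; positivity
  have hp0 : p ≠ 0 := norm_pos_iff.1 hpp
  have hc : ‖(p ^ m) ^ 2‖ < 1 := by
    rw [norm_pow, norm_pow]
    exact pow_lt_one₀ (by positivity) (pow_lt_one₀ (by positivity) hp1 hm) two_ne_zero
  have hset : {w | ‖qf B w - 1‖ < 1 ∧ ‖w‖ = (residueCard K : ℝ) ^ m} =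
      (fun v => p ^ m • v) ⁻¹'
        {w | ‖w‖ = 1 ∧ ‖(qf B w - (p ^ m) ^ 2) / p ^ (2 * m + 1)‖ ≤ 1} := by
    ext w
    simp only [Set.mem_ofPred_eq, Set.mem_preimage]
    rw [and_comm]
    refine and_congr ?_ ?_
    · rw [norm_smul, norm_pow, hp, inv_pow, inv_mul_eq_div, div_eq_one_iff_eq (by positivity)]
    · rw [qf_smul, show ((p ^ m) ^ 2 * qf B w - (p ^ m) ^ 2) / p ^ (2 * m + 1) =
        (qf B w - 1) / p by field_simp; ring, norm_div, div_le_one hpp, hp]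
      exact ⟨norm_le_of_lt_one hK, fun h => h.trans_lt (hp ▸ hp1)⟩
  have hmeas : MeasurableSet
      {w | ‖w‖ = 1 ∧ ‖(qf B w - (p ^ m) ^ 2) / p ^ (2 * m + 1)‖ ≤ 1} :=
    (isClosed_eq continuous_norm continuous_const).measurableSet.inter
      (isClosed_le (((continuous_qf B).sub continuous_const).div_const _).norm
        continuous_const).measurableSet
  rw [hset, measure_preimage_pow_smul vol hK hp m hmeas,
    ← measure_near_level vol hK h2 hp hBs hB hdet hc (2 * m)]
  ring

end Volume

/-! ### The two point counts in factored form -/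

section Counting

variable {F : Type*} [Field F] [Fintype F] [DecidableEq F] {ι : Type*} [Fintype ι] [DecidableEq ι]

theorem card_qf_eq_one (hF : ringChar F ≠ 2) {B : Matrix ι ι F} (hB : B.IsSymm)
    (hdet : B.det ≠ 0) {r : ℕ} (hr : Fintype.card ι = 2 * (r + 1)) :
    ((Finset.univ.filter fun a : ι → F => qf B a = 1).card : ℤ) =
      (Fintype.card F : ℤ) ^ r *
        ((Fintype.card F : ℤ) ^ (r + 1) - quadraticChar F ((-1) ^ (r + 1) * B.det)) := by
  have h := card_quadric hF B hB hdet hr 1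
  rw [if_neg one_ne_zero] at h
  have hq : (Fintype.card F : ℤ) ≠ 0 := by exact_mod_cast Fintype.card_ne_zero
  apply mul_left_cancel₀ hq
  change _ * ((Finset.univ.filter fun v : ι → F => v ⬝ᵥ B *ᵥ v = 1).card : ℤ) = _
  rw [h]; ring

theorem card_isotropic (hF : ringChar F ≠ 2) {B : Matrix ι ι F} (hB : B.IsSymm)
    (hdet : B.det ≠ 0) {r : ℕ} (hr : Fintype.card ι = 2 * (r + 1)) :
    ((Finset.univ.filter fun a : ι → F => a ≠ 0 ∧ qf B a = 0).card : ℤ) =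
      ((Fintype.card F : ℤ) ^ r + quadraticChar F ((-1) ^ (r + 1) * B.det)) *
        ((Fintype.card F : ℤ) ^ (r + 1) - quadraticChar F ((-1) ^ (r + 1) * B.det)) := by
  have h := card_quadric hF B hB hdet hr 0
  rw [if_pos rfl] at h
  have hq : (Fintype.card F : ℤ) ≠ 0 := by exact_mod_cast Fintype.card_ne_zero
  have hε := quadraticChar_sq_one (F := F) (a := (-1) ^ (r + 1) * B.det)
    (mul_ne_zero (pow_ne_zero _ (neg_ne_zero.2 one_ne_zero)) hdet)
  have hcard : (Finset.univ.filter fun v : ι → F => v ⬝ᵥ B *ᵥ v = 0).card =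
      (Finset.univ.filter fun a : ι → F => a ≠ 0 ∧ qf B a = 0).card + 1 := by
    have h0 : (Finset.univ.filter fun v : ι → F => v ⬝ᵥ B *ᵥ v = 0).erase 0 =
        Finset.univ.filter fun a : ι → F => a ≠ 0 ∧ qf B a = 0 := by
      ext a
      simp only [Finset.mem_erase, Finset.mem_filter, Finset.mem_univ, true_and]
      rfl
    rw [← Finset.card_erase_add_one (a := (0 : ι → F)) (by simp), h0]
  rw [hcard] at h
  push_cast at h
  apply mul_left_cancel₀ hq
  -- The relation $\varepsilon^2=1$ is what makes the count of nonzero isotropic vectors factor.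
  linear_combination h + (Fintype.card F : ℤ) * hε

end Counting

/-! ### The Haar integral over the neighbourhood of the quadric -/

section LevelSum

set_option linter.unusedSectionVars false

variable {K : Type*} [NontriviallyNormedField K] [IsUltrametricDist K]
  {ι : Type*} [Fintype ι]

/-- The vectors where the quadratic form takes values in `1 + 𝔭`. -/
def nearOne (B : Matrix ι ι K) : Set (ι → K) := {v | ‖qf B v - 1‖ < 1}

theorem isOpen_nearOne (B : Matrix ι ι K) : IsOpen (nearOne B) :=
  isOpen_lt ((continuous_qf B).sub continuous_const).norm continuous_const

theorem exists_norm_apply_eq_norm {v : ι → K} (hv : v ≠ 0) : ∃ i, ‖v i‖ = ‖v‖ := by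
  by_contra! h
  have : ‖v‖ < ‖v‖ := (pi_norm_lt_iff (norm_pos_iff.2 hv)).2 fun i =>
    lt_of_le_of_ne (norm_le_pi_norm v i) (h i)
  exact lt_irrefl _ this

theorem one_le_norm_of_mem_nearOne {B : Matrix ι ι K} (hB : ∀ i j, ‖B i j‖ ≤ 1) {v : ι → K}
    (hv : v ∈ nearOne B) : 1 ≤ ‖v‖ := by
  have h1 : ‖qf B v‖ = 1 := norm_eq_one_of_sub_lt (norm_one (α := K)) hv
  have h2 := norm_qf_le hB v
  rw [h1] at h2
  nlinarith [norm_nonneg v]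

theorem exists_norm_eq_pow (hK : IsNormalizedAbs K) {v : ι → K} (hv : 1 ≤ ‖v‖) :
    ∃ m : ℕ, ‖v‖ = (residueCard K : ℝ) ^ m := by
  have hq := one_lt_residueCard_real hK
  have hv0 : v ≠ 0 := by intro h; rw [h, norm_zero] at hv; linarith
  obtain ⟨i, hi⟩ := exists_norm_apply_eq_norm hv0
  have hvi : v i ≠ 0 := by
    rw [← norm_pos_iff, hi]; linarith
  obtain ⟨m, hm⟩ := norm_eq_zpow hK hvi
  rw [hi] at hm
  have hm0 : 0 ≤ m := by
    rw [hm] at hv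
    exact (one_le_zpow_iff_right₀ hq).1 hv
  lift m to ℕ using hm0
  exact ⟨m, by rw [hm, zpow_natCast]⟩

variable [ProperSpace K] [MeasurableSpace K] [BorelSpace K]
  (vol : Measure (ι → K)) [vol.IsAddHaarMeasure]

/-- The integrand is constant on the shells $\|v\|=q^m$, $m\ge0$. Their volumes grow like $q^{2rm}$,
so the sum is geometric from $m=1$ on, with ratio $q^{2r-\alpha}$; this accounts for the condition
$\operatorname{Re}\alpha>2r$. -/
theorem integral_nearOne_norm_cpow [DecidableEq ι] (hK : IsNormalizedAbs K) (h2 : ‖(2 : K)‖ = 1)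
    {B : Matrix ι ι K} (hBs : B.IsSymm) (hB : ∀ i j, ‖B i j‖ ≤ 1) (hdet : ‖B.det‖ = 1)
    {r : ℕ} (hr : Fintype.card ι = 2 * (r + 1)) {α : ℂ} (hα : ((2 * r : ℕ) : ℝ) < α.re) :
    IntegrableOn (fun v => ((‖v‖ : ℝ) : ℂ) ^ (-α)) (nearOne B) vol ∧
    ∫ v in nearOne B, ((‖v‖ : ℝ) : ℂ) ^ (-α) ∂vol =
      ((vol.real (Metric.ball 0 1) *
        (((residueCard K : ℝ) ^ (r + 1) - quadChar ((-1) ^ (r + 1) * B.det)) *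
          (residueCard K : ℝ) ^ r) : ℝ) : ℂ) *
      (1 + quadChar ((-1) ^ (r + 1) * B.det) * (residueCard K : ℂ) ^ ((r : ℂ) - α)) /
        (1 - (residueCard K : ℂ) ^ ((2 * r : ℂ) - α)) := by
  classical
  have := finite_residue hK
  have : Fintype (Residue K) := Fintype.ofFinite _
  have hq := one_lt_residueCard_real hK
  have hqF : residueCard K = Fintype.card (Residue K) := Nat.card_eq_fintype_card
  have hdetr : (B.map red).det ≠ 0 := by
    rw [← red_det hB, Ne, red_eq_zero_iff hdet.le, hdet]
    exact lt_irrefl _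
  have hBsr : (B.map red).IsSymm := hBs.map red
  -- The sign $(-1)^{r+1}$ has to be carried through `red`, which is not a ring homomorphism on all
  -- of $K$.
  have hε : quadChar ((-1) ^ (r + 1) * B.det) =
      quadraticChar (Residue K) ((-1) ^ (r + 1) * (B.map red).det) := by
    rw [quadChar_eq_quadraticChar_red h2 (by simp [hdet]), red_mul (by simp) hdet.le, red_det hB]
    congr 2
    rcases neg_one_pow_eq_or K (r + 1) with h | h <;>
      rcases Nat.even_or_odd (r + 1) with h' | h' <;>
      simp only [h'.neg_one_pow]
    all_goals
      first
        | exact red_one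
        | rw [← zero_sub, red_sub (by simp) (by simp), red_zero, red_one, zero_sub]
  have hF := ringChar_residue_ne_two h2
  have hA0 := card_qf_eq_one hF hBsr hdetr hr
  have hA1 := card_isotropic hF hBsr hdetr hr
  rw [← hε, ← hqF] at hA0 hA1
  set ε : ℤ := quadChar ((-1) ^ (r + 1) * B.det) with hεdef
  set A0 := (Finset.univ.filter fun a : ι → Residue K => qf (B.map red) a = 1).card
  set A1 := (Finset.univ.filter fun a : ι → Residue K => a ≠ 0 ∧ qf (B.map red) a = 0).card
  set q := residueCard K with hqdef
  set V := vol.real (Metric.ball 0 1) with hV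
  have hq0 : (0 : ℝ) < q := by linarith
  have hqc : (q : ℂ) ≠ 0 := by exact_mod_cast hq0.ne'
  set y : ℂ := (q : ℂ) ^ ((2 * r : ℂ) - α) with hy
  have hynorm : ‖y‖ < 1 := by
    rw [hy, show (q : ℂ) = ((q : ℝ) : ℂ) by simp, Complex.norm_cpow_eq_rpow_re_of_pos hq0]
    refine Real.rpow_lt_one_of_one_lt_of_neg hq ?_
    rw [Complex.sub_re]
    have : ((2 * r : ℂ)).re = ((2 * r : ℕ) : ℝ) := by
      rw [← Complex.natCast_re]; push_cast; rfl
    rw [this]; linarith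
  let W : ℕ → Set (ι → K) := fun m => {w | ‖qf B w - 1‖ < 1 ∧ ‖w‖ = (q : ℝ) ^ m}
  have hWU : nearOne B = ⋃ m, W m := by
    ext v
    simp only [Set.mem_iUnion]
    constructor
    · intro hv
      obtain ⟨m, hm⟩ := exists_norm_eq_pow hK (one_le_norm_of_mem_nearOne hB hv)
      exact ⟨m, hv, hm⟩
    · rintro ⟨m, hv, -⟩
      exact hv
  have hWm : ∀ m, MeasurableSet (W m) := fun m =>
    (isOpen_nearOne B).measurableSet.inter
      (isClosed_eq continuous_norm continuous_const).measurableSet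
  have hWd : Pairwise (Function.onFun Disjoint W) := by
    intro a b hab
    refine Set.disjoint_left.2 fun v hv hv' => hab ?_
    exact (pow_right_injective₀ hq0 hq.ne') (hv.2.symm.trans hv'.2)
  have hvol0 : vol.real (W 0) = A0 * V := by
    have h : W 0 = {w | ‖qf B w - 1‖ < 1 ∧ ‖w‖ = 1} := by simp [W]
    rw [h, measureReal_def, measure_level_zero vol hB, ENNReal.toReal_mul]
    simp [hV, measureReal_def, A0]
  have hvol : ∀ m : ℕ, m ≠ 0 → vol.real (W m) = ((q : ℝ) ^ (2 * r)) ^ m * A1 * V := by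
    intro m hm
    have := congrArg ENNReal.toReal (measure_level_succ vol hK h2 hBs hB hdet hm)
    simp only [ENNReal.toReal_mul, ENNReal.toReal_pow, ENNReal.toReal_natCast, hr] at this
    have h3 : ((q : ℝ) ^ (2 * m)) ≠ 0 := by positivity
    apply mul_left_cancel₀ h3
    rw [measureReal_def, hV, measureReal_def]
    refine this.trans ?_
    ring
  let f : (ι → K) → ℂ := fun v => ((‖v‖ : ℝ) : ℂ) ^ (-α)
  let u : ℕ → ℂ := fun m => (((q : ℝ) ^ m : ℝ) : ℂ) ^ (-α)
  have hfu : ∀ m, ∀ v ∈ W m, f v = u m := fun m v hv => by simp only [f, u, hv.2]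
  have huy : ∀ m, u m * ((q : ℂ) ^ (2 * r)) ^ m = y ^ m := by
    intro m
    have h3 : u m = ((q : ℂ) ^ (-α)) ^ m := by
      simp only [u]
      rw [← Real.rpow_natCast, Complex.ofReal_cpow hq0.le, ← Complex.cpow_nat_mul]
      rw [Complex.ofReal_natCast, Complex.ofReal_natCast,
        Complex.natCast_cpow_natCast_mul]
      norm_cast
    rw [h3, ← mul_pow, hy, sub_eq_add_neg, Complex.cpow_add _ _ hqc, mul_comm]
    congr 2
    rw [show (2 * r : ℂ) = ((2 * r : ℕ) : ℂ) by push_cast; rfl, Complex.cpow_natCast]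
  have hint : ∀ m, ∫ v in W m, f v ∂vol = vol.real (W m) * u m := by
    intro m
    rw [setIntegral_congr_fun (hWm m) (hfu m), setIntegral_const, Complex.real_smul]
  have hintn : ∀ m, ∫ v in W m, ‖f v‖ ∂vol = ‖(vol.real (W m) : ℂ) * u m‖ := by
    intro m
    rw [setIntegral_congr_fun (g := fun _ => ‖u m‖) (hWm m)
      (fun v hv => by rw [hfu m v hv]), setIntegral_const, norm_mul, smul_eq_mul,
      Complex.norm_real, Real.norm_of_nonneg measureReal_nonneg]
  have hterm : ∀ m, (vol.real (W (m + 1)) : ℂ) * u (m + 1) = A1 * V * y * y ^ m := by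
    intro m
    rw [hvol (m + 1) (by omega)]
    have := huy (m + 1)
    rw [pow_succ y] at this
    push_cast
    linear_combination (A1 * V : ℂ) * this
  have hsum : HasSum (fun m => (vol.real (W m) : ℂ) * u m)
      ((vol.real (W 0) : ℂ) * u 0 + A1 * V * y * (1 - y)⁻¹) := by
    rw [add_comm]
    refine (hasSum_nat_add_iff' 1).1 ?_
    simp only [hterm, Finset.sum_range_one, add_sub_cancel_right]
    exact (hasSum_geometric_of_norm_lt_one hynorm).mul_left _
  have hfin : ∀ m, vol (W m) ≠ ⊤ := fun m =>
    ((measure_mono (fun v hv => mem_closedBall_zero_iff.2 hv.2.le)).trans_lt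
      (isCompact_closedBall (0 : ι → K) ((q : ℝ) ^ m)).measure_lt_top).ne
  have hInt : IntegrableOn f (⋃ m, W m) vol := by
    refine integrableOn_iUnion_of_summable_integral_norm (fun m => ?_) ?_
    · refine (integrableOn_const (C := u m) (hfin m)).congr_fun ?_ (hWm m)
      exact fun v hv => (hfu m v hv).symm
    · simp only [hintn]
      exact hsum.summable.norm
  rw [hWU]
  refine ⟨hInt, ?_⟩
  have h3 := hasSum_integral_iUnion hWm hWd hInt
  simp only [hint] at h3
  rw [show ∫ v in ⋃ m, W m, ((‖v‖ : ℝ) : ℂ) ^ (-α) ∂vol = ∫ v in ⋃ m, W m, f v ∂vol from rfl,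
    h3.unique hsum, hvol0]
  have hu0 : u 0 = 1 := by simp [u]
  have hy1 : 1 - y ≠ 0 := by
    intro h
    rw [← sub_eq_zero.1 h] at hynorm
    simp at hynorm
  -- This splitting lets the factor $q^r$ be pulled out:
  -- $A_0+A_1y/(1-y)=(q^{r+1}-\varepsilon)(q^r+\varepsilon y)/(1-y)$.
  have hyx : y = (q : ℂ) ^ r * (q : ℂ) ^ ((r : ℂ) - α) := by
    rw [hy, ← Complex.cpow_natCast, ← Complex.cpow_add _ _ hqc]
    congr 1; ring
  have hA0' : (A0 : ℂ) = (q : ℂ) ^ r * ((q : ℂ) ^ (r + 1) - ε) := by exact_mod_cast hA0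
  have hA1' : (A1 : ℂ) = ((q : ℂ) ^ r + ε) * ((q : ℂ) ^ (r + 1) - ε) := by exact_mod_cast hA1
  rw [hu0]
  push_cast
  rw [hA0', hA1']
  field_simp
  rw [hyx]
  ring

end LevelSum

/-! ### Reflections, their negatives, and transitivity on the quadric -/

section Reflection

set_option linter.unusedSectionVars false

variable {R : Type*} [Field R] {ι : Type*} [Fintype ι] [DecidableEq ι]

/-- An isometry of order at most two, acting on row vectors from the right. -/
structure IsInvolutiveIsometry (B g : Matrix ι ι R) : Prop where
  isom : g * B * gᵀ = B
  mul_self : g * g = 1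

theorem IsInvolutiveIsometry.neg {B g : Matrix ι ι R} (h : IsInvolutiveIsometry B g) :
    IsInvolutiveIsometry B (-g) :=
  ⟨by simp [h.isom], by simp [h.mul_self]⟩

theorem IsInvolutiveIsometry.vecMul_vecMul {B g : Matrix ι ι R} (h : IsInvolutiveIsometry B g)
    (v : ι → R) : (v ᵥ* g) ᵥ* g = v := by
  rw [Matrix.vecMul_vecMul, h.mul_self, Matrix.vecMul_one]

theorem IsInvolutiveIsometry.qf_vecMul {B g : Matrix ι ι R} (h : IsInvolutiveIsometry B g)
    (v : ι → R) : qf B (v ᵥ* g) = qf B v := by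
  rw [qf, qf, ← Matrix.mulVec_transpose g v, Matrix.mulVec_mulVec, Matrix.mulVec_transpose,
    ← Matrix.dotProduct_mulVec, Matrix.mulVec_mulVec, ← Matrix.mul_assoc, h.isom]

/-- The negative of the reflection in the hyperplane orthogonal to `a`. -/
def negReflection (B : Matrix ι ι R) (a : ι → R) : Matrix ι ι R :=
  (2 / qf B a) • Matrix.vecMulVec (B *ᵥ a) a - 1

theorem vecMul_negReflection (B : Matrix ι ι R) (a v : ι → R) :
    v ᵥ* negReflection B a = (2 * (v ⬝ᵥ B *ᵥ a) / qf B a) • a - v := by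
  rw [negReflection, Matrix.vecMul_sub, Matrix.vecMul_one, Matrix.vecMul_smul,
    Matrix.vecMul_vecMulVec, smul_smul]
  congr 2
  ring

theorem isInvolutiveIsometry_negReflection {B : Matrix ι ι R} (hB : B.IsSymm) {a : ι → R}
    (ha : qf B a ≠ 0) : IsInvolutiveIsometry B (negReflection B a) := by
  have h1 : a ᵥ* B = B *ᵥ a := by rw [← Matrix.mulVec_transpose, hB.eq]
  have h2 : (B *ᵥ a) ⬝ᵥ a = qf B a := by rw [dotProduct_comm]; rfl
  constructor
  · simp only [negReflection, Matrix.transpose_sub, Matrix.transpose_one, Matrix.transpose_smul,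
      Matrix.transpose_vecMulVec, Matrix.sub_mul, Matrix.mul_sub, Matrix.smul_mul,
      Matrix.mul_smul, Matrix.one_mul, Matrix.mul_one, Matrix.vecMulVec_mul, h1,
      Matrix.mul_vecMulVec, Matrix.sub_mulVec, Matrix.smul_mulVec, Matrix.vecMulVec_mulVec, h2]
    ext i j
    simp only [Matrix.sub_apply, Pi.sub_apply, Matrix.smul_apply, Matrix.vecMulVec_apply, smul_eq_mul,
      Pi.smul_apply, MulOpposite.smul_eq_mul_unop, MulOpposite.unop_op]
    field_simp
    ring
  · simp only [negReflection, Matrix.sub_mul, Matrix.mul_sub, Matrix.smul_mul,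
      Matrix.mul_smul, Matrix.one_mul, Matrix.mul_one, Matrix.vecMulVec_mul,
      Matrix.vecMul_vecMulVec]
    ext i j
    simp only [Matrix.sub_apply, Matrix.smul_apply, Matrix.vecMulVec_apply, smul_eq_mul,
      Pi.smul_apply]
    rw [show a ⬝ᵥ B *ᵥ a = qf B a from rfl]
    field_simp
    ring

theorem vecMul_negReflection_add {B : Matrix ι ι R} (hB : B.IsSymm) {x y : ι → R}
    (hx : qf B x = 1) (hy : qf B y = 1) (hxy : qf B (x + y) ≠ 0) :
    x ᵥ* negReflection B (x + y) = y := by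
  have h : 2 * (x ⬝ᵥ B *ᵥ (x + y)) = qf B (x + y) := by
    rw [qf_add hB, Matrix.mulVec_add, dotProduct_add, hy, show x ⬝ᵥ B *ᵥ x = qf B x from rfl, hx]
    ring
  rw [vecMul_negReflection, h, div_self hxy, one_smul, add_sub_cancel_left]

theorem qf_add_add_qf_sub {B : Matrix ι ι R} (hB : B.IsSymm) (x y : ι → R) :
    qf B (x + y) + qf B (x - y) = 2 * qf B x + 2 * qf B y := by
  have h := qf_smul B (-1) y
  rw [sub_eq_add_neg, qf_add hB, qf_add hB, ← neg_one_smul R y, h, Matrix.mulVec_smul,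
    dotProduct_smul, smul_eq_mul]
  ring

/-- By the parallelogram law $\mathrm{qf}(x+y)+\mathrm{qf}(x-y)=4\ne0$, so at least one of $x\pm y$
is anisotropic. The negated reflection in $x+y$, or the reflection in $x-y$, then carries $x$ to
$y$. -/
theorem exists_involutiveIsometry {B : Matrix ι ι R} (hB : B.IsSymm) (h2 : (2 : R) ≠ 0)
    {x y : ι → R} (hx : qf B x = 1) (hy : qf B y = 1) :
    ∃ g, IsInvolutiveIsometry B g ∧ x ᵥ* g = y := by
  by_cases hxy : qf B (x + y) = 0
  · have h := qf_add_add_qf_sub hB x y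
    rw [hxy, hx, hy, zero_add, sub_eq_add_neg] at h
    have h0 : qf B (x + -y) ≠ 0 := by
      rw [h, show (2 * 1 + 2 * 1 : R) = 2 * 2 by norm_num]; exact mul_ne_zero h2 h2
    have hny : qf B (-y) = 1 := by
      rw [← neg_one_smul R y, qf_smul, hy]; norm_num
    refine ⟨-negReflection B (x + -y), (isInvolutiveIsometry_negReflection hB h0).neg, ?_⟩
    rw [Matrix.vecMul_neg, vecMul_negReflection_add hB hx hny h0, neg_neg]
  · exact ⟨_, isInvolutiveIsometry_negReflection hB hxy, vecMul_negReflection_add hB hx hy hxy⟩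

end Reflection

/-! ### Effect of isometries on the sup norm and on Haar measure -/

section Isometry

set_option linter.unusedSectionVars false

variable {K : Type*} [NontriviallyNormedField K] [IsUltrametricDist K]
  {ι : Type*} [Fintype ι] [DecidableEq ι]

theorem continuous_vecMul (g : Matrix ι ι K) : Continuous fun v : ι → K => v ᵥ* g :=
  continuous_id.matrix_vecMul continuous_const

/-- The parallelogram law gives $\mathrm{qf}(x+y)=4-\mathrm{qf}(x-y)$, a unit minus an element of
$\mathfrak p$. So the reflection joining nearby points has no denominators. -/
theorem norm_qf_add_eq_one {B : Matrix ι ι K} (hBs : B.IsSymm) (hB : ∀ i j, ‖B i j‖ ≤ 1)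
    (h2 : ‖(2 : K)‖ = 1) {x y : ι → K} (hx : qf B x = 1) (hy : qf B y = 1) (hxy : ‖y - x‖ < 1) :
    ‖qf B (x + y)‖ = 1 := by
  have h := qf_add_add_qf_sub hBs x y
  rw [hx, hy] at h
  refine norm_eq_one_of_sub_lt (y := 2 * 2) (by rw [norm_mul, h2, one_mul]) ?_
  rw [show qf B (x + y) - 2 * 2 = - qf B (x - y) by linear_combination h, norm_neg]
  refine (norm_qf_le hB _).trans_lt ?_
  rw [norm_sub_rev]
  exact pow_lt_one₀ (norm_nonneg _) hxy two_ne_zero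

/-- An integral $a$ with $\mathrm{qf}(a)$ a unit gives a norm-nonincreasing map; being its own
inverse, it preserves the norm. -/
theorem norm_vecMul_negReflection {B : Matrix ι ι K} (hBs : B.IsSymm) (hB : ∀ i j, ‖B i j‖ ≤ 1)
    (h2 : ‖(2 : K)‖ = 1) {a : ι → K} (ha : ‖a‖ ≤ 1) (hqa : ‖qf B a‖ = 1) (v : ι → K) :
    ‖v ᵥ* negReflection B a‖ = ‖v‖ := by
  have hle : ∀ w : ι → K, ‖w ᵥ* negReflection B a‖ ≤ ‖w‖ := by
    intro w
    rw [vecMul_negReflection, sub_eq_add_neg]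
    refine (IsUltrametricDist.norm_add_le_max _ _).trans (max_le ?_ (norm_neg w).le)
    rw [norm_smul, norm_div, norm_mul, h2, hqa, div_one, one_mul]
    have := norm_dotProduct_mulVec_le hB w a
    nlinarith [norm_nonneg w, norm_nonneg a, norm_nonneg (w ⬝ᵥ B *ᵥ a),
      mul_nonneg (norm_nonneg w) (norm_nonneg a)]
  have hinv := isInvolutiveIsometry_negReflection hBs
    (a := a) (by rw [← norm_pos_iff, hqa]; exact one_pos)
  refine le_antisymm (hle v) ?_
  have := hle (v ᵥ* negReflection B a)
  rwa [hinv.vecMul_vecMul] at this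

theorem norm_add_le_one_of_near {x y : ι → K} (hx : ‖x‖ ≤ 1) (hxy : ‖y - x‖ < 1) :
    ‖x + y‖ ≤ 1 := by
  have hy : ‖y‖ ≤ 1 := by
    have := IsUltrametricDist.norm_add_le_max (y - x) x
    rw [sub_add_cancel] at this
    exact this.trans (max_le hxy.le hx)
  exact (IsUltrametricDist.norm_add_le_max _ _).trans (max_le hx hy)

variable [ProperSpace K] [MeasurableSpace K] [BorelSpace K]

/-- The scaling constant squares to $1$ because the map is an involution, and it is nonnegative. -/
theorem map_vecMul_addHaar (vol : Measure (ι → K)) [vol.IsAddHaarMeasure] {B g : Matrix ι ι K}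
    (hg : IsInvolutiveIsometry B g) : vol.map (fun v => v ᵥ* g) = vol := by
  let L : (ι → K) ≃L[K] (ι → K) :=
    (LinearEquiv.ofInvolutive (Matrix.vecMulLinear g) hg.vecMul_vecMul).toContinuousLinearEquiv
  obtain ⟨c, hc⟩ := exists_map_linearEquiv_eq_smul vol L
  have hL : (⇑L : (ι → K) → (ι → K)) = fun v => v ᵥ* g := rfl
  rw [hL] at hc
  have hm := (continuous_vecMul g).measurable
  have h1 : c * c = 1 := by
    have h2 : (vol.map fun v => v ᵥ* g).map (fun v => v ᵥ* g) = vol := by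
      rw [Measure.map_map hm hm]
      have : (fun v : ι → K => v ᵥ* g) ∘ (fun v => v ᵥ* g) = id := funext hg.vecMul_vecMul
      rw [this, Measure.map_id]
    rw [hc, Measure.map_smul, hc, smul_smul] at h2
    have h3 := congrArg (fun m => m (Metric.ball 0 1)) h2
    simp only [Measure.smul_apply, ENNReal.smul_def, smul_eq_mul] at h3
    have h4 := (ENNReal.mul_left_inj (measure_ball_ne_zero vol) (measure_ball_ne_top vol)).1
      (h3.trans (one_mul _).symm)
    exact_mod_cast h4
  have h5 : c = 1 := by
    rw [← sq] at h1
    exact (pow_eq_one_iff_of_nonneg zero_le two_ne_zero).1 h1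
  rw [hc, h5, one_smul]

end Isometry

/-! ### Uniqueness of the invariant measure on the quadric -/

section Uniqueness

set_option linter.unusedSectionVars false

variable {K : Type*} [NontriviallyNormedField K] [IsUltrametricDist K]
  {ι : Type*} [Fintype ι] [DecidableEq ι]
  [ProperSpace K] [MeasurableSpace K] [BorelSpace K]

/-- Measures on the quadric `qf B = 1` which are invariant under involutive isometries. -/
structure IsQuadricMeasure (B : Matrix ι ι K) (x : ι → K) (μ : Measure (ι → K)) : Prop where
  null : μ {v | qf B v ≠ 1} = 0
  map_eq : ∀ g, IsInvolutiveIsometry B g → μ.map (fun v => v ᵥ* g) = μ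
  ball_ne_top : μ (Metric.ball x 1) ≠ ⊤

variable {B : Matrix ι ι K} {x : ι → K} {μ ν : Measure (ι → K)}

/-- The negated reflection in $x+y$ takes $x$ to $y$ and preserves the sup norm, hence exchanges
balls of equal radius about the two points. -/
theorem IsQuadricMeasure.measure_ball (hμ : IsQuadricMeasure B x μ) (hBs : B.IsSymm)
    (hB : ∀ i j, ‖B i j‖ ≤ 1) (h2 : ‖(2 : K)‖ = 1) (hx : qf B x = 1) (hx1 : ‖x‖ ≤ 1) {y : ι → K}
    (hy : qf B y = 1) (hxy : y ∈ Metric.ball x 1) (r : ℝ) :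
    μ (Metric.ball y r) = μ (Metric.ball x r) := by
  rw [mem_ball_iff_norm] at hxy
  have hq := norm_qf_add_eq_one hBs hB h2 hx hy hxy
  have hq0 : qf B (x + y) ≠ 0 := by rw [← norm_pos_iff, hq]; exact one_pos
  have hg := isInvolutiveIsometry_negReflection hBs hq0
  have hxg := vecMul_negReflection_add hBs hx hy hq0
  have hn := norm_vecMul_negReflection hBs hB h2 (norm_add_le_one_of_near hx1 hxy) hq
  conv_lhs => rw [← hμ.map_eq _ hg,
    Measure.map_apply (continuous_vecMul _).measurable measurableSet_ball]
  congr 1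
  ext v
  rw [Set.mem_preimage, mem_ball_iff_norm, mem_ball_iff_norm, ← hn (v - x), Matrix.sub_vecMul, hxg]

theorem IsQuadricMeasure.ae (hμ : IsQuadricMeasure B x μ) : ∀ᵐ v ∂μ, qf B v = 1 := by
  rw [ae_iff]; exact hμ.null

theorem lintegral_measure_ball (hμ : IsQuadricMeasure B x μ) (hν : IsQuadricMeasure B x ν)
    (hBs : B.IsSymm) (hB : ∀ i j, ‖B i j‖ ≤ 1) (h2 : ‖(2 : K)‖ = 1) (hx : qf B x = 1)
    (hx1 : ‖x‖ ≤ 1) {r : ℝ} (hr : r ≤ 1) :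
    ∫⁻ y, ν.restrict (Metric.ball x 1) (Metric.ball y r) ∂(μ.restrict (Metric.ball x 1)) =
      ν (Metric.ball x r) * μ (Metric.ball x 1) := by
  have : ∀ᵐ y ∂(μ.restrict (Metric.ball x 1)),
      ν.restrict (Metric.ball x 1) (Metric.ball y r) = ν (Metric.ball x r) := by
    filter_upwards [ae_restrict_of_ae hμ.ae, ae_restrict_mem measurableSet_ball] with y hy hyx
    rw [Measure.restrict_apply measurableSet_ball, Set.inter_eq_left.2,
      hν.measure_ball hBs hB h2 hx hx1 hy hyx]
    rw [IsUltrametricDist.ball_eq_of_mem hyx]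
    exact Metric.ball_subset_ball hr
  rw [lintegral_congr_ae this, lintegral_const, Measure.restrict_apply_univ]

/-- Tonelli for the symmetric set $\{\operatorname{dist}(y,z)<r\}$ under the product of the two
restricted measures. By homogeneity each iterated integral has a constant integrand, and the two
evaluations are the two sides. -/
theorem measure_ball_mul_comm (hμ : IsQuadricMeasure B x μ) (hν : IsQuadricMeasure B x ν)
    (hBs : B.IsSymm) (hB : ∀ i j, ‖B i j‖ ≤ 1) (h2 : ‖(2 : K)‖ = 1) (hx : qf B x = 1)
    (hx1 : ‖x‖ ≤ 1) {r : ℝ} (hr : r ≤ 1) :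
    ν (Metric.ball x r) * μ (Metric.ball x 1) = μ (Metric.ball x r) * ν (Metric.ball x 1) := by
  have : Fact (μ (Metric.ball x 1) < ⊤) := ⟨hμ.ball_ne_top.lt_top⟩
  have : Fact (ν (Metric.ball x 1) < ⊤) := ⟨hν.ball_ne_top.lt_top⟩
  rw [← lintegral_measure_ball hμ hν hBs hB h2 hx hx1 hr,
    ← lintegral_measure_ball hν hμ hBs hB h2 hx hx1 hr]
  have hS : MeasurableSet {p : (ι → K) × (ι → K) | dist p.2 p.1 < r} :=
    (isOpen_lt (continuous_snd.dist continuous_fst) continuous_const).measurableSet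
  have h1 := Measure.prod_apply (μ := μ.restrict (Metric.ball x 1))
    (ν := ν.restrict (Metric.ball x 1)) hS
  have h3 := Measure.prod_apply_symm (μ := μ.restrict (Metric.ball x 1))
    (ν := ν.restrict (Metric.ball x 1)) hS
  refine Eq.trans ?_ ((h1.symm.trans h3).trans ?_)
  · rfl
  · refine lintegral_congr fun y => ?_
    congr 1
    ext z
    simp [dist_comm]

theorem isTopologicalBasis_small_balls :
    TopologicalSpace.IsTopologicalBasis
      {s : Set (ι → K) | ∃ x r, 0 < r ∧ r ≤ 1 ∧ s = Metric.ball x r} := by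
  refine TopologicalSpace.isTopologicalBasis_of_isOpen_of_nhds ?_ ?_
  · rintro _ ⟨x, r, -, -, rfl⟩
    exact Metric.isOpen_ball
  · intro a u ha hu
    obtain ⟨ε, hε, h⟩ := Metric.isOpen_iff.1 hu a ha
    exact ⟨_, ⟨a, min ε 1, lt_min hε one_pos, min_le_right _ _, rfl⟩,
      Metric.mem_ball_self (lt_min hε one_pos),
      (Metric.ball_subset_ball (min_le_left _ _)).trans h⟩

/-- Small balls together with the empty set are stable under intersection, so agreement on balls
suffices. A ball meeting $Q\cap B(x,1)$ may be recentred at a point of $Q$; for any other ball the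
part inside $B(x,1)$ is null for both measures. -/
theorem restrict_ball_eq_smul (hμ : IsQuadricMeasure B x μ) (hν : IsQuadricMeasure B x ν)
    (hBs : B.IsSymm) (hB : ∀ i j, ‖B i j‖ ≤ 1) (h2 : ‖(2 : K)‖ = 1) (hx : qf B x = 1)
    (hx1 : ‖x‖ ≤ 1) (hν0 : ν (Metric.ball x 1) ≠ 0) :
    μ.restrict (Metric.ball x 1) =
      (μ (Metric.ball x 1) / ν (Metric.ball x 1)) • ν.restrict (Metric.ball x 1) := by
  have : Fact (μ (Metric.ball x 1) < ⊤) := ⟨hμ.ball_ne_top.lt_top⟩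
  set c := μ (Metric.ball x 1) / ν (Metric.ball x 1) with hc
  have key : ∀ r ≤ 1, μ (Metric.ball x r) = c * ν (Metric.ball x r) := by
    intro r hr
    have h := measure_ball_mul_comm hμ hν hBs hB h2 hx hx1 hr
    rw [hc, mul_comm, ← mul_div_assoc, h,
      ENNReal.mul_div_cancel_right hν0 hν.ball_ne_top]
  have hgen : (inferInstance : MeasurableSpace (ι → K)) = MeasurableSpace.generateFrom
      {s : Set (ι → K) | ∃ x r, 0 < r ∧ r ≤ 1 ∧ s = Metric.ball x r} := by
    rw [BorelSpace.measurable_eq (α := ι → K)]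
    exact isTopologicalBasis_small_balls.borel_eq_generateFrom
  refine ext_of_generate_finite _ hgen ?_ ?_ ?_
  · rintro _ ⟨a, r, hr, hr1, rfl⟩ _ ⟨b, s, hs, hs1, rfl⟩ ⟨z, hza, hzb⟩
    refine ⟨z, min r s, lt_min hr hs, (min_le_left _ _).trans hr1, ?_⟩
    rw [IsUltrametricDist.ball_eq_of_mem hza, IsUltrametricDist.ball_eq_of_mem hzb]
    ext w
    simp
  · rintro _ ⟨b, r, hr, hr1, rfl⟩
    rw [Measure.smul_apply, Measure.restrict_apply measurableSet_ball,
      Measure.restrict_apply measurableSet_ball, smul_eq_mul]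
    by_cases h : ∃ y ∈ Metric.ball b r ∩ Metric.ball x 1, qf B y = 1
    · obtain ⟨y, ⟨hyb, hyx⟩, hy⟩ := h
      have hsub : Metric.ball y r ⊆ Metric.ball x 1 := by
        rw [IsUltrametricDist.ball_eq_of_mem hyx]
        exact Metric.ball_subset_ball hr1
      rw [IsUltrametricDist.ball_eq_of_mem hyb, Set.inter_eq_left.2 hsub,
        hμ.measure_ball hBs hB h2 hx hx1 hy hyx, hν.measure_ball hBs hB h2 hx hx1 hy hyx,
        key r hr1]
    · push Not at h
      rw [measure_mono_null h hμ.null, measure_mono_null h hν.null, mul_zero]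
  · rw [Measure.smul_apply, Measure.restrict_apply_univ, Measure.restrict_apply_univ, smul_eq_mul,
      key 1 le_rfl]

/-- Uniqueness of the invariant measure on the quadric `qf B = 1`. -/
theorem IsQuadricMeasure.eq_smul (hμ : IsQuadricMeasure B x μ) (hν : IsQuadricMeasure B x ν)
    (hBs : B.IsSymm) (hB : ∀ i j, ‖B i j‖ ≤ 1) (h2 : ‖(2 : K)‖ = 1) (hx : qf B x = 1)
    (hx1 : ‖x‖ ≤ 1) (hν0 : ν (Metric.ball x 1) ≠ 0) :
    μ = (μ (Metric.ball x 1) / ν (Metric.ball x 1)) • ν := by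
  set c := μ (Metric.ball x 1) / ν (Metric.ball x 1) with hc
  have h20 : (2 : K) ≠ 0 := by rw [← norm_pos_iff, h2]; exact one_pos
  -- Near a point of $Q$ the identity is transported from the ball at $x$ by an involution; off $Q$,
  -- an open set null for both measures serves. Second countability then glues these local
  -- identities.
  have hloc : ∀ z : ι → K, ∃ U ∈ nhds z, MeasurableSet U ∧ μ.restrict U = c • ν.restrict U := by
    intro z
    by_cases hz : qf B z = 1
    · obtain ⟨g, hg, hxg⟩ := exists_involutiveIsometry hBs h20 hx hz
      have hzg : z ᵥ* g = x := by rw [← hxg, hg.vecMul_vecMul]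
      have hgm := (continuous_vecMul g).measurable
      have hU := hgm (measurableSet_ball (x := x) (ε := 1))
      refine ⟨(fun v => v ᵥ* g) ⁻¹' Metric.ball x 1,
        (continuous_vecMul g).continuousAt.preimage_mem_nhds
          (by rw [hzg]; exact Metric.ball_mem_nhds x one_pos), hU, ?_⟩
      ext A hA
      have hpre : ∀ m : Measure (ι → K), IsQuadricMeasure B x m →
          m.restrict ((fun v => v ᵥ* g) ⁻¹' Metric.ball x 1) A =
            m.restrict (Metric.ball x 1) ((fun v => v ᵥ* g) ⁻¹' A) := by
        intro m hm
        rw [Measure.restrict_apply hA, Measure.restrict_apply (hgm hA), ← hm.map_eq g hg,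
          Measure.map_apply hgm (hA.inter hU), hm.map_eq g hg]
        congr 1
        ext v
        simp only [Set.mem_preimage, Set.mem_inter_iff, hg.vecMul_vecMul]
      rw [Measure.smul_apply, hpre μ hμ, hpre ν hν,
        restrict_ball_eq_smul hμ hν hBs hB h2 hx hx1 hν0, Measure.smul_apply]
    · have hopen : IsOpen {v | qf B v ≠ 1} := isOpen_ne_fun (continuous_qf B) continuous_const
      refine ⟨_, hopen.mem_nhds hz, hopen.measurableSet, ?_⟩
      rw [Measure.restrict_eq_zero.2 hμ.null, Measure.restrict_eq_zero.2 hν.null, smul_zero]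
  choose U hU hUm hUe using hloc
  obtain ⟨s, hs, hcov⟩ := TopologicalSpace.countable_cover_nhds hU
  have : Countable s := hs.to_subtype
  have h3 := (Measure.restrict_iUnion_congr (μ := μ) (ν := c • ν) (s := fun i : s => U i)).2
    fun i => by rw [Measure.restrict_smul]; exact hUe i
  rw [← Set.biUnion_eq_iUnion s (fun x _ => U x), hcov, Measure.restrict_univ,
    Measure.restrict_univ] at h3
  exact h3

end Uniqueness

/-! ### An explicit invariant measure on the quadric -/

section QuadricMeasure

set_option linter.unusedSectionVars false

variable {K : Type*} [NontriviallyNormedField K] [IsUltrametricDist K]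

open Classical in
/-- The square root in `1 + 𝔭`, extended by one. -/
def unitSqrt (u : K) : K :=
  if h : ∃ s : K, ‖s - 1‖ < 1 ∧ s ^ 2 = u then h.choose else 1

theorem norm_unitSqrt_sub_one_lt (u : K) : ‖unitSqrt u - 1‖ < 1 := by
  rw [unitSqrt]
  split_ifs with h
  · exact h.choose_spec.1
  · simp

theorem norm_unitSqrt (u : K) : ‖unitSqrt u‖ = 1 :=
  norm_eq_one_of_sub_lt norm_one (norm_unitSqrt_sub_one_lt u)

theorem unitSqrt_ne_zero (u : K) : unitSqrt u ≠ 0 := by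
  rw [← norm_pos_iff, norm_unitSqrt]; exact one_pos

theorem unitSqrt_sq [CompleteSpace K] (h2 : ‖(2 : K)‖ = 1) {u : K} (hu : ‖u - 1‖ < 1) :
    unitSqrt u ^ 2 = u := by
  have h := exists_sqrt_of_norm_sub_one_lt h2 hu
  rw [unitSqrt, dif_pos h]
  exact h.choose_spec.2

/-- Squares of elements of $1+\mathfrak p$ stay in $1+\mathfrak p$, so elsewhere the default value
applies. This makes `unitSqrt` piecewise continuous, hence measurable. -/
theorem unitSqrt_eq_one [CompleteSpace K] {u : K} (hu : ¬ ‖u - 1‖ < 1) : unitSqrt u = 1 := by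
  rw [unitSqrt, dif_neg]
  rintro ⟨s, hs, rfl⟩
  apply hu
  have hs1 : ‖s + 1‖ ≤ 1 := (IsUltrametricDist.norm_add_le_max _ _).trans
    (max_le (norm_eq_one_of_sub_lt norm_one hs).le norm_one.le)
  rw [show s ^ 2 - 1 = (s + 1) * (s - 1) by ring, norm_mul]
  nlinarith [norm_nonneg (s - 1)]

theorem measurable_unitSqrt [CompleteSpace K] [MeasurableSpace K] [BorelSpace K]
    (h2 : ‖(2 : K)‖ = 1) : Measurable (unitSqrt : K → K) := by
  classical
  have h1 : ContinuousOn (unitSqrt : K → K) (Metric.ball 1 1) := by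
    refine LipschitzOnWith.continuousOn (K := 1) (LipschitzOnWith.of_dist_le_mul ?_)
    intro u hu v hv
    rw [mem_ball_iff_norm] at hu hv
    rw [dist_eq_norm, dist_eq_norm, norm_sub_eq_norm_sq_sub h2 (norm_unitSqrt_sub_one_lt u)
      (norm_unitSqrt_sub_one_lt v), unitSqrt_sq h2 hu, unitSqrt_sq h2 hv]
    simp
  have h3 := h1.measurable_piecewise (g := fun _ => (1 : K)) continuousOn_const measurableSet_ball
  convert h3 using 1
  funext u
  by_cases hu : u ∈ Metric.ball (1 : K) 1
  · rw [Set.piecewise_eq_of_mem _ _ _ hu]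
  · rw [Set.piecewise_eq_of_notMem _ _ _ hu]
    rw [mem_ball_iff_norm] at hu
    exact unitSqrt_eq_one hu

variable {ι : Type*} [Fintype ι]

/-- Normalization of vectors to the quadric `qf B = 1`. -/
def toQuadric (B : Matrix ι ι K) (v : ι → K) : ι → K := (unitSqrt (qf B v))⁻¹ • v

theorem norm_toQuadric (B : Matrix ι ι K) (v : ι → K) : ‖toQuadric B v‖ = ‖v‖ := by
  rw [toQuadric, norm_smul, norm_inv, norm_unitSqrt, inv_one, one_mul]

theorem qf_toQuadric [CompleteSpace K] (h2 : ‖(2 : K)‖ = 1) {B : Matrix ι ι K} {v : ι → K}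
    (hv : v ∈ nearOne B) : qf B (toQuadric B v) = 1 := by
  rw [toQuadric, qf_smul, inv_pow, unitSqrt_sq h2 hv, inv_mul_cancel₀]
  have : ‖qf B v‖ = 1 := norm_eq_one_of_sub_lt norm_one hv
  rw [← norm_pos_iff, this]; exact one_pos

theorem norm_toQuadric_sub_lt (B : Matrix ι ι K) {v : ι → K} (hv : ‖v‖ ≤ 1) :
    ‖toQuadric B v - v‖ < 1 := by
  set s := unitSqrt (qf B v) with hs
  have : toQuadric B v - v = (s⁻¹ * (1 - s)) • v := by
    rw [toQuadric, ← hs, mul_sub, mul_one, inv_mul_cancel₀ (unitSqrt_ne_zero _), sub_smul, one_smul]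
  rw [this, norm_smul, norm_mul, norm_inv, norm_unitSqrt, inv_one, one_mul, norm_sub_rev]
  have := norm_unitSqrt_sub_one_lt (qf B v)
  nlinarith [norm_nonneg v, norm_nonneg (s - 1)]

variable [DecidableEq ι]

theorem toQuadric_vecMul {B g : Matrix ι ι K} (hg : IsInvolutiveIsometry B g) (v : ι → K) :
    toQuadric B (v ᵥ* g) = toQuadric B v ᵥ* g := by
  rw [toQuadric, toQuadric, hg.qf_vecMul, Matrix.smul_vecMul]

variable [ProperSpace K] [MeasurableSpace K] [BorelSpace K]

theorem measurable_toQuadric (h2 : ‖(2 : K)‖ = 1) (B : Matrix ι ι K) :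
    Measurable (toQuadric B) :=
  ((measurable_unitSqrt h2).comp (continuous_qf B).measurable).inv.smul measurable_id

/-- The image on the quadric `qf B = 1` of the Haar measure near the quadric. -/
def quadricMeasure (B : Matrix ι ι K) (vol : Measure (ι → K)) : Measure (ι → K) :=
  (vol.restrict (nearOne B)).map (toQuadric B)

variable (vol : Measure (ι → K)) [vol.IsAddHaarMeasure]

/-- Normalization commutes with isometries, which preserve both Haar measure and the condition
$\mathrm{qf}\in1+\mathfrak p$. Finiteness near $x$ holds because normalization preserves the norm,
so the preimage of the ball stays in the integral vectors. -/
theorem isQuadricMeasure_quadricMeasure (h2 : ‖(2 : K)‖ = 1) (B : Matrix ι ι K) {x : ι → K}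
    (hx1 : ‖x‖ ≤ 1) : IsQuadricMeasure B x (quadricMeasure B vol) := by
  have hm := measurable_toQuadric h2 B
  have hWm := (isOpen_nearOne B).measurableSet
  constructor
  · have hopen : IsOpen {v | qf B v ≠ 1} := isOpen_ne_fun (continuous_qf B) continuous_const
    rw [quadricMeasure, Measure.map_apply hm hopen.measurableSet,
      Measure.restrict_apply (hm hopen.measurableSet), ← measure_empty (μ := vol)]
    congr 1
    exact Set.eq_empty_of_forall_notMem fun v hv => hv.1 (qf_toQuadric h2 hv.2)
  · intro g hg
    have hgm := (continuous_vecMul g).measurable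
    have hW : (fun v => v ᵥ* g) ⁻¹' nearOne B = nearOne B := by
      ext v
      simp only [nearOne, Set.mem_preimage, Set.mem_ofPred_eq, hg.qf_vecMul]
    have hcomm : (fun v => v ᵥ* g) ∘ toQuadric B = toQuadric B ∘ fun v => v ᵥ* g :=
      funext fun v => (toQuadric_vecMul hg v).symm
    rw [quadricMeasure, Measure.map_map hgm hm, hcomm, ← Measure.map_map hm hgm]
    congr 1
    conv_rhs => rw [← map_vecMul_addHaar vol hg, Measure.restrict_map hgm hWm, hW]
  · rw [quadricMeasure, Measure.map_apply hm measurableSet_ball]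
    refine ((Measure.restrict_apply_le _ _).trans_lt ((measure_mono fun v hv => ?_).trans_lt
      (isCompact_closedBall (0 : ι → K) 1).measure_lt_top)).ne
    rw [Set.mem_preimage, mem_ball_iff_norm] at hv
    rw [mem_closedBall_zero_iff, ← norm_toQuadric B]
    have := IsUltrametricDist.norm_add_le_max (toQuadric B v - x) x
    rw [sub_add_cancel] at this
    exact this.trans (max_le hv.le hx1)

/-- The whole ball $B(x,1)$ lies in `nearOne B`, and normalization moves its points by less than
$1$, so this ball is contained in its own preimage. -/
theorem quadricMeasure_ball_ne_zero (h2 : ‖(2 : K)‖ = 1) {B : Matrix ι ι K}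
    (hBs : B.IsSymm) (hB : ∀ i j, ‖B i j‖ ≤ 1) {x : ι → K} (hx : qf B x = 1) (hx1 : ‖x‖ ≤ 1) :
    quadricMeasure B vol (Metric.ball x 1) ≠ 0 := by
  rw [quadricMeasure, Measure.map_apply (measurable_toQuadric h2 B) measurableSet_ball,
    Measure.restrict_apply (measurable_toQuadric h2 B measurableSet_ball)]
  refine ((Metric.isOpen_ball.measure_pos vol ⟨x, Metric.mem_ball_self one_pos⟩).trans_le
    (measure_mono (s := Metric.ball x 1) fun v hv => ?_)).ne'
  rw [mem_ball_iff_norm] at hv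
  have hv1 : ‖v‖ ≤ 1 := by
    have := IsUltrametricDist.norm_add_le_max (v - x) x
    rw [sub_add_cancel] at this
    exact this.trans (max_le hv.le hx1)
  constructor
  · rw [Set.mem_preimage, mem_ball_iff_norm,
      show toQuadric B v - x = (toQuadric B v - v) + (v - x) by abel]
    exact (IsUltrametricDist.norm_add_le_max _ _).trans_lt
      (max_lt (norm_toQuadric_sub_lt B hv1) hv)
  · have h := qf_add hBs x (v - x)
    rw [add_sub_cancel, hx] at h
    change ‖qf B v - 1‖ < 1
    rw [show qf B v - 1 = 2 * (x ⬝ᵥ B *ᵥ (v - x)) + qf B (v - x) by linear_combination h]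
    refine (IsUltrametricDist.norm_add_le_max _ _).trans_lt (max_lt ?_ ?_)
    · rw [norm_mul, h2, one_mul]
      refine (norm_dotProduct_mulVec_le hB _ _).trans_lt ?_
      nlinarith [norm_nonneg x, norm_nonneg (v - x)]
    · exact (norm_qf_le hB _).trans_lt (pow_lt_one₀ (norm_nonneg _) hv two_ne_zero)

/-- Integrals of powers of the norm with respect to an invariant measure on the quadric. -/
theorem IsQuadricMeasure.integral_norm_cpow (hK : IsNormalizedAbs K) (h2 : ‖(2 : K)‖ = 1)
    {B : Matrix ι ι K} (hBs : B.IsSymm) (hB : ∀ i j, ‖B i j‖ ≤ 1) (hdet : ‖B.det‖ = 1)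
    {r : ℕ} (hr : Fintype.card ι = 2 * (r + 1)) {x : ι → K} (hx : qf B x = 1) (hx1 : ‖x‖ ≤ 1)
    {μ : Measure (ι → K)} (hμ : IsQuadricMeasure B x μ) (hμ0 : μ ≠ 0) :
    ∃ C : ℝ, 0 < C ∧ ∀ α : ℂ, ((2 * r : ℕ) : ℝ) < α.re →
      Integrable (fun v => ((‖v‖ : ℝ) : ℂ) ^ (-α)) μ ∧
      ∫ v, ((‖v‖ : ℝ) : ℂ) ^ (-α) ∂μ = C *
        ((1 + quadChar ((-1) ^ (r + 1) * B.det) * (residueCard K : ℂ) ^ ((r : ℂ) - α)) /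
          (1 - (residueCard K : ℂ) ^ ((2 * r : ℂ) - α))) := by
  let vol : Measure (ι → K) := Measure.addHaar
  have hν := isQuadricMeasure_quadricMeasure vol h2 B hx1
  have hν0 := quadricMeasure_ball_ne_zero vol h2 hBs hB hx hx1
  have hμν := hμ.eq_smul hν hBs hB h2 hx hx1 hν0
  set c := μ (Metric.ball x 1) / quadricMeasure B vol (Metric.ball x 1) with hc
  have hctop : c ≠ ⊤ := ENNReal.div_ne_top hμ.ball_ne_top hν0
  have hc0 : c ≠ 0 := by
    intro h
    rw [h, zero_smul] at hμν
    exact hμ0 hμν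
  have hq := one_lt_residueCard_real hK
  have hV : 0 < vol.real (Metric.ball 0 1) :=
    ENNReal.toReal_pos (measure_ball_ne_zero vol) (measure_ball_ne_top vol)
  have hε : (quadChar ((-1) ^ (r + 1) * B.det) : ℝ) ≤ 1 := by
    rw [quadChar]; split_ifs <;> norm_num
  have hpow : 1 < (residueCard K : ℝ) ^ (r + 1) := one_lt_pow₀ hq (by omega)
  -- The constant is the ratio of the two measures times the factor of the Haar integral that is
  -- independent of $\alpha$; it is positive since $q^{r+1}>1\ge\varepsilon$.
  refine ⟨c.toReal * (vol.real (Metric.ball 0 1) *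
    (((residueCard K : ℝ) ^ (r + 1) - quadChar ((-1) ^ (r + 1) * B.det)) *
      (residueCard K : ℝ) ^ r)), ?_, fun α hα => ?_⟩
  · refine mul_pos (ENNReal.toReal_pos hc0 hctop) (mul_pos hV (mul_pos ?_ ?_))
    · linarith
    · positivity
  · obtain ⟨h1, h3⟩ := integral_nearOne_norm_cpow vol hK h2 hBs hB hdet hr hα
    have hm := measurable_toQuadric h2 B
    have hf : Measurable fun v : ι → K => ((‖v‖ : ℝ) : ℂ) ^ (-α) :=
      (Complex.measurable_ofReal.comp measurable_norm).pow_const _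
    have hcomp : (fun v : ι → K => ((‖toQuadric B v‖ : ℝ) : ℂ) ^ (-α)) =
        fun v => ((‖v‖ : ℝ) : ℂ) ^ (-α) := by
      funext v; rw [norm_toQuadric]
    rw [hμν]
    constructor
    · refine Integrable.smul_measure ?_ hctop
      rw [quadricMeasure, integrable_map_measure hf.aestronglyMeasurable hm.aemeasurable]
      change Integrable (fun v : ι → K => ((‖toQuadric B v‖ : ℝ) : ℂ) ^ (-α)) _
      rw [hcomp]
      exact h1
    · rw [integral_smul_measure, quadricMeasure,
        integral_map hm.aemeasurable hf.aestronglyMeasurable, hcomp, h3, Complex.real_smul]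
      push_cast
      ring

end QuadricMeasure

/-! ### The spherical function as a power of the sup norm -/

section SphericalFunction

set_option linter.unusedSectionVars false

variable {K : Type*} [NontriviallyNormedField K] [IsUltrametricDist K]
  [ProperSpace K] [MeasurableSpace K] [BorelSpace K]

/-- Measurable sets of units are pulled back from $K$, whereas their topology also involves the
inverse. In a topological field the inclusion of the units is nevertheless an embedding, so the two
structures agree. -/
theorem borelSpace_units : BorelSpace Kˣ := by
  constructor
  have h1 : (inferInstance : TopologicalSpace Kˣ) =
      TopologicalSpace.induced Units.val inferInstance :=
    (Units.isEmbedding_val₀ (G₀ := K)).eq_induced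
  have h2 : (inferInstance : MeasurableSpace Kˣ) = MeasurableSpace.comap Units.val (borel K) := by
    rw [← BorelSpace.measurable_eq (α := K)]; rfl
  exact h2.trans ((borel_comap (f := (Units.val : Kˣ → K))).symm.trans (by rw [← h1]))

/-- The integrand of the local zeta integral of the characteristic function of the integers. -/
def tateIntegrand (α : ℂ) (t : Kˣ) : ℂ :=
  Set.indicator {t : Kˣ | ‖(t : K)‖ ≤ 1} (fun t => ((‖(t : K)‖ : ℝ) : ℂ) ^ α) t

theorem continuous_norm_units : Continuous fun t : Kˣ => ‖(t : K)‖ :=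
  continuous_norm.comp Units.continuous_val

/-- The shells of norm $q^{-m}$ are translates of the compact open group $\mathfrak o^\times$, so
the integral is $\operatorname{vol}(\mathfrak o^\times)/(1-q^{-\alpha})$, which is nonzero. -/
theorem integral_tateIntegrand (hK : IsNormalizedAbs K) (τ : Measure Kˣ) [τ.IsHaarMeasure] {α : ℂ}
    (hα : 0 < α.re) :
    Integrable (tateIntegrand α) τ ∧ ∫ t, tateIntegrand α t ∂τ ≠ 0 := by
  have := borelSpace_units (K := K)
  have hq := one_lt_residueCard_real hK
  set q := residueCard K with hqdef
  have hq0 : (0 : ℝ) < q := by linarith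
  obtain ⟨p, hp⟩ := exists_uniformizer hK
  rw [← hqdef] at hp
  have hpp : 0 < ‖p‖ := by rw [hp]; positivity
  let p' : Kˣ := Units.mk0 p (norm_pos_iff.1 hpp)
  let A : ℕ → Set Kˣ := fun m => {t | ‖(t : K)‖ = (q : ℝ)⁻¹ ^ m}
  have hAm : ∀ m, MeasurableSet (A m) := fun m =>
    (isClosed_eq continuous_norm_units continuous_const).measurableSet
  have hqi0 : (0 : ℝ) < (q : ℝ)⁻¹ := by positivity
  have hqi1 : (q : ℝ)⁻¹ < 1 := inv_lt_one_of_one_lt₀ hq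
  have hAd : Pairwise (Function.onFun Disjoint A) := by
    intro a b hab
    refine Set.disjoint_left.2 fun v hv hv' => hab ?_
    exact (pow_right_injective₀ hqi0 hqi1.ne) (hv.symm.trans hv')
  have hAU : {t : Kˣ | ‖(t : K)‖ ≤ 1} = ⋃ m, A m := by
    ext t
    simp only [Set.mem_iUnion, Set.mem_ofPred_eq, A]
    constructor
    · intro ht
      obtain ⟨m, hm⟩ := norm_eq_zpow hK t.ne_zero
      rw [hm, zpow_le_one_iff_right₀ hq] at ht
      obtain ⟨k, rfl⟩ := Int.exists_eq_neg_ofNat ht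
      exact ⟨k, by rw [hm, zpow_neg, zpow_natCast, inv_pow]⟩
    · rintro ⟨m, hm⟩
      rw [hm]
      exact pow_le_one₀ hqi0.le hqi1.le
  have hA0 : ∀ m, τ (A m) = τ (A 0) := by
    intro m
    rw [← measure_preimage_mul τ (p' ^ m)⁻¹ (A 0)]
    congr 1
    ext t
    simp only [A, Set.mem_ofPred_eq, Set.mem_preimage, pow_zero, Units.val_mul, norm_mul]
    rw [← inv_pow, Units.val_pow_eq_pow_val, norm_pow]
    rw [Units.val_inv_eq_inv_val, norm_inv, Units.val_mk0, hp, inv_inv, inv_pow,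
      ← mul_eq_one_iff_eq_inv₀ (by positivity), mul_comm]
  have hAcomp : IsCompact (A 0) := by
    have hS : IsCompact (Metric.sphere (0 : K) 1) := isCompact_sphere 0 1
    rw [(Units.isEmbedding_val₀ (G₀ := K)).isCompact_iff]
    convert hS using 1
    ext x
    simp only [A, Set.mem_image, Set.mem_ofPred_eq, pow_zero, mem_sphere_zero_iff_norm]
    constructor
    · rintro ⟨t, ht, rfl⟩; exact ht
    · intro hx
      exact ⟨Units.mk0 x (by rw [← norm_pos_iff, hx]; exact one_pos), hx, rfl⟩
  have hAopen : IsOpen (A 0) := by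
    have : A 0 = Units.val ⁻¹' (Metric.sphere (0 : K) 1) := by
      ext t; simp [A]
    rw [this]
    exact (IsUltrametricDist.isOpen_sphere (0 : K) one_ne_zero).preimage Units.continuous_val
  have htop : τ (A 0) ≠ ⊤ := hAcomp.measure_lt_top.ne
  have hpos : 0 < τ.real (A 0) :=
    ENNReal.toReal_pos (hAopen.measure_pos τ ⟨1, by simp [A]⟩).ne' htop
  let z : ℂ := (q : ℂ) ^ (-α)
  have hz : ‖z‖ < 1 := by
    simp only [z]
    rw [show (q : ℂ) = ((q : ℝ) : ℂ) by simp, Complex.norm_cpow_eq_rpow_re_of_pos hq0]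
    refine Real.rpow_lt_one_of_one_lt_of_neg hq ?_
    rw [Complex.neg_re]; linarith
  let f : Kˣ → ℂ := fun t => ((‖(t : K)‖ : ℝ) : ℂ) ^ α
  have hfz : ∀ m, ∀ t ∈ A m, f t = z ^ m := by
    intro m t ht
    have ht' : ‖(t : K)‖ = (q : ℝ)⁻¹ ^ m := ht
    have hzi : (((q : ℝ)⁻¹ : ℝ) : ℂ) ^ α = z := by
      rw [Complex.ofReal_inv, Complex.ofReal_natCast, Complex.inv_cpow _ _
        (by rw [Complex.natCast_arg]; exact Real.pi_pos.ne), ← Complex.cpow_neg]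
    simp only [f, ht']
    clear ht ht'
    induction m with
    | zero => simp
    | succ m ih =>
      rw [pow_succ, Complex.ofReal_mul, Complex.mul_cpow_ofReal_nonneg (by positivity) hqi0.le,
        ih, hzi, pow_succ]
  have hint : ∀ m, ∫ t in A m, f t ∂τ = τ.real (A 0) * z ^ m := by
    intro m
    rw [setIntegral_congr_fun (hAm m) (hfz m), setIntegral_const, Complex.real_smul,
      measureReal_def, hA0, measureReal_def]
  have hintn : ∀ m, ∫ t in A m, ‖f t‖ ∂τ = ‖(τ.real (A 0) : ℂ) * z ^ m‖ := by
    intro m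
    rw [setIntegral_congr_fun (g := fun _ => ‖z ^ m‖) (hAm m)
      (fun t ht => by rw [hfz m t ht]), setIntegral_const, norm_mul, smul_eq_mul,
      Complex.norm_real, Real.norm_of_nonneg measureReal_nonneg, measureReal_def, hA0,
      measureReal_def]
  have hsum : HasSum (fun m => (τ.real (A 0) : ℂ) * z ^ m) (τ.real (A 0) * (1 - z)⁻¹) :=
    (hasSum_geometric_of_norm_lt_one hz).mul_left _
  have hInt : IntegrableOn f (⋃ m, A m) τ := by
    refine integrableOn_iUnion_of_summable_integral_norm (fun m => ?_) ?_
    · refine (integrableOn_const (C := z ^ m) (by rw [hA0]; exact htop)).congr_fun ?_ (hAm m)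
      exact fun t ht => (hfz m t ht).symm
    · simp only [hintn]
      exact hsum.summable.norm
  have hU : MeasurableSet {t : Kˣ | ‖(t : K)‖ ≤ 1} := by
    rw [hAU]; exact MeasurableSet.iUnion hAm
  have heq : (tateIntegrand α : Kˣ → ℂ) = Set.indicator {t : Kˣ | ‖(t : K)‖ ≤ 1} f := rfl
  rw [heq]
  constructor
  · rw [integrable_indicator_iff hU, hAU]
    exact hInt
  · rw [integral_indicator hU, hAU]
    have h3 := hasSum_integral_iUnion hAm hAd hInt
    simp only [hint] at h3
    rw [h3.unique hsum]
    refine mul_ne_zero (by exact_mod_cast hpos.ne') (inv_ne_zero ?_)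
    intro h
    rw [← sub_eq_zero.1 h] at hz
    simp at hz

theorem Phi_smul {n : ℕ} (t : K) (w : Idx n → K) :
    Phi (t • w) = if ‖t‖ * ‖w‖ ≤ 1 then 1 else 0 := by
  have h : t • w ∈ {w : Idx n → K | ∀ i, ‖w i‖ ≤ 1} ↔ ‖t‖ * ‖w‖ ≤ 1 := by
    rw [← norm_smul, pi_norm_le_iff_of_nonneg zero_le_one]; rfl
  by_cases h1 : ‖t‖ * ‖w‖ ≤ 1
  · rw [if_pos h1, Phi, Set.indicator_of_mem (h.2 h1)]; rfl
  · rw [if_neg h1, Phi, Set.indicator_of_notMem (fun h2 => h1 (h.1 h2))]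

/-- The sup norm is homogeneous, so $\Phi(te\cdot g)$ is the condition $\|ut\|\le1$ for a scalar $u$
with $\|u\|=\|e\cdot g\|$. Translating $t$ by $u$ then isolates the dependence on $g$. -/
theorem integrand_eq {n : ℕ} (s : ℂ) (g : GL (Idx n) K) (u : Kˣ)
    (hu : ‖(u : K)‖ = ‖(ePlus K n + eMinus K n) ᵥ* g.1‖) (t : Kˣ) :
    integrand s g t = ((‖(u : K)‖ : ℝ) : ℂ) ^ (-((n + 1 : ℂ) * s)) *
      tateIntegrand ((n + 1 : ℂ) * s) (u * t) := by
  have hu0 : 0 < ‖(u : K)‖ := norm_pos_iff.2 u.ne_zero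
  have huc : ((‖(u : K)‖ : ℝ) : ℂ) ≠ 0 := by exact_mod_cast hu0.ne'
  have hmem : u * t ∈ {t : Kˣ | ‖(t : K)‖ ≤ 1} ↔ ‖(t : K)‖ * ‖(u : K)‖ ≤ 1 := by
    rw [Set.mem_ofPred_eq, Units.val_mul, norm_mul, mul_comm]
  rw [integrand, Matrix.smul_vecMul, Phi_smul, ← hu, tateIntegrand]
  by_cases h : ‖(t : K)‖ * ‖(u : K)‖ ≤ 1
  · rw [if_pos h, Set.indicator_of_mem (hmem.2 h), mul_one, Units.val_mul, norm_mul,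
      Complex.ofReal_mul, Complex.mul_cpow_ofReal_nonneg (norm_nonneg _) (norm_nonneg _),
      ← mul_assoc, ← Complex.cpow_add _ _ huc, neg_add_cancel, Complex.cpow_zero, one_mul]
  · rw [if_neg h, Set.indicator_of_notMem (fun h' => h (hmem.1 h')), mul_zero, mul_zero]

theorem exists_unit_norm_eq {n : ℕ} {g : GL (Idx n) K} :
    ∃ u : Kˣ, ‖(u : K)‖ = ‖(ePlus K n + eMinus K n) ᵥ* g.1‖ := by
  have he : ePlus K n + eMinus K n ≠ 0 := by
    intro h
    have := congrFun h (Sum.inl ())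
    simp [ePlus, eMinus] at this
  have hw : (ePlus K n + eMinus K n) ᵥ* g.1 ≠ 0 := by
    intro h
    apply he
    have h1 : g.1 * (g⁻¹).1 = 1 := g.mul_inv
    rw [← Matrix.vecMul_one (ePlus K n + eMinus K n), ← h1, ← Matrix.vecMul_vecMul, h,
      Matrix.zero_vecMul]
  obtain ⟨i, hi⟩ := exists_norm_apply_eq_norm hw
  refine ⟨Units.mk0 _ (?_ : ((ePlus K n + eMinus K n) ᵥ* g.1) i ≠ 0), hi⟩
  rw [← norm_pos_iff, hi]
  exact norm_pos_iff.2 hw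

theorem integrable_integrand {n : ℕ} (hK : IsNormalizedAbs K) (τ : Measure Kˣ) [τ.IsHaarMeasure]
    {s : ℂ} (hs : 0 < ((n + 1 : ℂ) * s).re) (g : GL (Idx n) K) : Integrable (integrand s g) τ := by
  have := borelSpace_units (K := K)
  obtain ⟨u, hu⟩ := exists_unit_norm_eq (g := g)
  rw [funext (integrand_eq s g u hu)]
  exact ((integral_tateIntegrand hK τ hs).1.comp_mul_left u).const_mul _

theorem phi_eq {n : ℕ} (τ : Measure Kˣ) [τ.IsHaarMeasure] (s : ℂ) (g : GL (Idx n) K) :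
    phi τ s g = ((‖(ePlus K n + eMinus K n) ᵥ* g.1‖ : ℝ) : ℂ) ^ (-((n + 1 : ℂ) * s)) *
      ∫ t, tateIntegrand ((n + 1 : ℂ) * s) t ∂τ := by
  have := borelSpace_units (K := K)
  obtain ⟨u, hu⟩ := exists_unit_norm_eq (g := g)
  rw [phi, funext (integrand_eq s g u hu), integral_const_mul,
    integral_mul_left_eq_self (tateIntegrand ((n + 1 : ℂ) * s)) u, hu]

theorem norm_ePlus_add_eMinus (n : ℕ) : ‖ePlus K n + eMinus K n‖ = 1 := by
  refine le_antisymm ((pi_norm_le_iff_of_nonneg zero_le_one).2 fun i => ?_) ?_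
  · rcases i with i | i | i <;> simp [ePlus, eMinus]
  · have := norm_le_pi_norm (ePlus K n + eMinus K n) (Sum.inl ())
    simpa [ePlus, eMinus] using this

theorem phi_one {n : ℕ} (τ : Measure Kˣ) [τ.IsHaarMeasure] (s : ℂ) :
    phi τ s (1 : GL (Idx n) K) = ∫ t, tateIntegrand ((n + 1 : ℂ) * s) t ∂τ := by
  rw [phi_eq]
  simp [norm_ePlus_add_eMinus]

theorem phiNormalized_eq {n : ℕ} (hK : IsNormalizedAbs K) (τ : Measure Kˣ) [τ.IsHaarMeasure]
    {s : ℂ} (hs : 0 < ((n + 1 : ℂ) * s).re) (g : GL (Idx n) K) :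
    phiNormalized τ s g =
      ((‖(ePlus K n + eMinus K n) ᵥ* g.1‖ : ℝ) : ℂ) ^ (-((n + 1 : ℂ) * s)) := by
  rw [phiNormalized, phi_one, phi_eq, mul_div_cancel_right₀ _ (integral_tateIntegrand hK τ hs).2]

end SphericalFunction

/-! ### The homogeneous space as a subset of the quadric -/

section Quotient

set_option linter.unusedSectionVars false

variable {K : Type*} [NontriviallyNormedField K] {n : ℕ}

/-- The Gram matrix of the form on `k e₊ ⊕ k ^ (n + 1)`. -/
def gramPlus (S : Matrix (Fin (n + 1)) (Fin (n + 1)) K) :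
    Matrix (Unit ⊕ Fin (n + 1)) (Unit ⊕ Fin (n + 1)) K :=
  Matrix.fromBlocks 1 0 0 S

theorem isSymm_gramPlus {S : Matrix (Fin (n + 1)) (Fin (n + 1)) K} (hS : S.IsSymm) :
    (gramPlus S).IsSymm :=
  Matrix.IsSymm.fromBlocks Matrix.isSymm_one (by simp) hS

theorem det_gramPlus (S : Matrix (Fin (n + 1)) (Fin (n + 1)) K) : (gramPlus S).det = S.det := by
  rw [gramPlus, Matrix.det_fromBlocks_zero₂₁, Matrix.det_one, one_mul]

theorem norm_gramPlus_le {S : Matrix (Fin (n + 1)) (Fin (n + 1)) K} (hS : ∀ i j, ‖S i j‖ ≤ 1)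
    (i j : Unit ⊕ Fin (n + 1)) : ‖gramPlus S i j‖ ≤ 1 := by
  rcases i with i | i <;> rcases j with j | j <;> simp [gramPlus, hS]

/-- The decomposition of `k ^ (n + 3)` into `k ^ (n + 2)` and `k e₋`. -/
def splitIdx (n : ℕ) : (Unit ⊕ Fin (n + 1)) ⊕ Unit ≃ Idx n := Equiv.sumAssoc _ _ _

/-- The coordinates along `k e₊ ⊕ k ^ (n + 1)`. -/
def projPlus (w : Idx n → K) : Unit ⊕ Fin (n + 1) → K := fun i => w (splitIdx n (Sum.inl i))

/-- The coordinate along `e₋`. -/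
def lastCoord (w : Idx n → K) : K := w (Sum.inr (Sum.inr ()))

theorem ext_coords {v w : Idx n → K} (h : projPlus v = projPlus w)
    (h' : lastCoord v = lastCoord w) : v = w := by
  funext i
  rcases i with i | i | i
  · exact congrFun h (Sum.inl i)
  · exact congrFun h (Sum.inr i)
  · exact h'

theorem gram_eq_reindex (S : Matrix (Fin (n + 1)) (Fin (n + 1)) K) :
    gram S = Matrix.reindexAlgEquiv K K (splitIdx n)
      (Matrix.fromBlocks (gramPlus S) 0 0 (-1)) := by
  ext i j
  rcases i with i | i | i <;> rcases j with j | j | j <;>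
    simp [gram, gramPlus, splitIdx]

theorem dotProduct_gram_mulVec (S : Matrix (Fin (n + 1)) (Fin (n + 1)) K) (v w : Idx n → K) :
    v ⬝ᵥ gram S *ᵥ w =
      projPlus v ⬝ᵥ gramPlus S *ᵥ projPlus w - lastCoord v * lastCoord w := by
  simp [dotProduct, Matrix.mulVec, gram, gramPlus, Fintype.sum_sum_type, projPlus, lastCoord,
    splitIdx]
  ring

/-- The extension by the identity on `k e₋`. -/
def extendMatrix (g : Matrix (Unit ⊕ Fin (n + 1)) (Unit ⊕ Fin (n + 1)) K) :
    Matrix (Idx n) (Idx n) K :=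
  Matrix.reindexAlgEquiv K K (splitIdx n) (Matrix.fromBlocks g 0 0 1)

theorem extendMatrix_mul_self {g : Matrix (Unit ⊕ Fin (n + 1)) (Unit ⊕ Fin (n + 1)) K}
    (hg : g * g = 1) : extendMatrix g * extendMatrix g = 1 := by
  rw [extendMatrix, ← map_mul, Matrix.fromBlocks_multiply]
  simp [hg]

theorem projPlus_eMinus : projPlus (eMinus K n) = 0 := by
  funext i
  rcases i with i | i <;> simp [projPlus, eMinus, splitIdx]

theorem projPlus_vecMul_extendMatrix (g : Matrix (Unit ⊕ Fin (n + 1)) (Unit ⊕ Fin (n + 1)) K)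
    (v : Idx n → K) : projPlus (v ᵥ* extendMatrix g) = projPlus v ᵥ* g := by
  funext i
  simp [projPlus, Matrix.vecMul, dotProduct, extendMatrix, splitIdx, Fintype.sum_sum_type]

theorem lastCoord_vecMul_extendMatrix (g : Matrix (Unit ⊕ Fin (n + 1)) (Unit ⊕ Fin (n + 1)) K)
    (v : Idx n → K) : lastCoord (v ᵥ* extendMatrix g) = lastCoord v := by
  simp [lastCoord, Matrix.vecMul, dotProduct, extendMatrix, splitIdx, Fintype.sum_sum_type]

variable {S : Matrix (Fin (n + 1)) (Fin (n + 1)) K}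

/-- Involutive isometries of `k ^ (n + 2)` as elements of `H`. -/
def extendInvolution (S : Matrix (Fin (n + 1)) (Fin (n + 1)) K)
    (g : Matrix (Unit ⊕ Fin (n + 1)) (Unit ⊕ Fin (n + 1)) K)
    (hg : IsInvolutiveIsometry (gramPlus S) g) : H S :=
  ⟨⟨extendMatrix g, extendMatrix g, extendMatrix_mul_self hg.mul_self,
    extendMatrix_mul_self hg.mul_self⟩, by
    constructor
    · change extendMatrix g * gram S * (extendMatrix g)ᵀ = gram S
      have ht : (extendMatrix g)ᵀ = Matrix.reindexAlgEquiv K K (splitIdx n)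
          (Matrix.fromBlocks gᵀ 0 0 1) := by
        rw [extendMatrix, Matrix.coe_reindexAlgEquiv, Matrix.transpose_reindex,
          Matrix.fromBlocks_transpose]
        simp
      rw [ht, gram_eq_reindex, extendMatrix, ← map_mul, ← map_mul, Matrix.fromBlocks_multiply,
        Matrix.fromBlocks_multiply]
      simp [hg.isom]
    · change eMinus K n ᵥ* extendMatrix g = eMinus K n
      refine ext_coords ?_ (lastCoord_vecMul_extendMatrix g _)
      rw [projPlus_vecMul_extendMatrix, projPlus_eMinus, Matrix.zero_vecMul]⟩

theorem coe_extendInvolution (g : Matrix (Unit ⊕ Fin (n + 1)) (Unit ⊕ Fin (n + 1)) K)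
    (hg : IsInvolutiveIsometry (gramPlus S) g) :
    (extendInvolution S g hg : GL (Idx n) K).1 = extendMatrix g := rfl

/-- The image of `e₊` under an element of `H`, in `k ^ (n + 2)`. -/
def orbitVec (h : H S) : Unit ⊕ Fin (n + 1) → K := projPlus (ePlus K n ᵥ* (h : GL (Idx n) K).1)

theorem dotProduct_gram_mulVec_vecMul (h : H S) (v w : Idx n → K) :
    (v ᵥ* (h : GL (Idx n) K).1) ⬝ᵥ gram S *ᵥ (w ᵥ* (h : GL (Idx n) K).1) =
      v ⬝ᵥ gram S *ᵥ w := by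
  have hG : (h : GL (Idx n) K).1 * gram S * ((h : GL (Idx n) K).1)ᵀ = gram S := h.2.1
  rw [← Matrix.mulVec_transpose _ w, Matrix.mulVec_mulVec, ← Matrix.dotProduct_mulVec,
    Matrix.mulVec_mulVec, ← Matrix.mul_assoc, hG]

theorem lastCoord_ePlus : lastCoord (ePlus K n) = 0 := by simp [lastCoord, ePlus]

theorem lastCoord_eMinus : lastCoord (eMinus K n) = 1 := by simp [lastCoord, eMinus]

theorem projPlus_ePlus : projPlus (ePlus K n) = Pi.single (Sum.inl ()) 1 := by
  funext i
  rcases i with i | i <;> simp [projPlus, ePlus, splitIdx]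

theorem qf_gramPlus_single (S : Matrix (Fin (n + 1)) (Fin (n + 1)) K) :
    qf (gramPlus S) (Pi.single (Sum.inl ()) 1) = 1 := by
  simp [qf, gramPlus]

theorem eMinus_vecMul (h : H S) : eMinus K n ᵥ* (h : GL (Idx n) K).1 = eMinus K n := h.2.2

/-- Elements of $H$ fix $e_-$ and preserve the form, so $e_+h$ remains orthogonal to $e_-$. -/
theorem lastCoord_ePlus_vecMul (h : H S) :
    lastCoord (ePlus K n ᵥ* (h : GL (Idx n) K).1) = 0 := by
  have h1 := dotProduct_gram_mulVec_vecMul h (ePlus K n) (eMinus K n)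
  rw [eMinus_vecMul, dotProduct_gram_mulVec, dotProduct_gram_mulVec, lastCoord_eMinus,
    projPlus_eMinus, lastCoord_ePlus] at h1
  simpa using h1

theorem qf_orbitVec (h : H S) : qf (gramPlus S) (orbitVec h) = 1 := by
  have h1 := dotProduct_gram_mulVec_vecMul h (ePlus K n) (ePlus K n)
  rw [dotProduct_gram_mulVec, dotProduct_gram_mulVec, lastCoord_ePlus_vecMul, lastCoord_ePlus,
    projPlus_ePlus, mul_zero, sub_zero, sub_zero] at h1
  exact h1.trans (qf_gramPlus_single S)

theorem ePlus_vecMul_injective {a b : H S} (h : orbitVec a = orbitVec b) :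
    ePlus K n ᵥ* (a : GL (Idx n) K).1 = ePlus K n ᵥ* (b : GL (Idx n) K).1 :=
  ext_coords h (by rw [lastCoord_ePlus_vecMul, lastCoord_ePlus_vecMul])

theorem orbitVec_mul_extendInvolution (h : H S)
    (g : Matrix (Unit ⊕ Fin (n + 1)) (Unit ⊕ Fin (n + 1)) K)
    (hg : IsInvolutiveIsometry (gramPlus S) g) :
    orbitVec (h * extendInvolution S g hg) = orbitVec h ᵥ* g := by
  rw [orbitVec, Subgroup.coe_mul, Units.val_mul, ← Matrix.vecMul_vecMul, coe_extendInvolution,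
    projPlus_vecMul_extendMatrix]
  rfl

theorem orbitVec_extendInvolution (g : Matrix (Unit ⊕ Fin (n + 1)) (Unit ⊕ Fin (n + 1)) K)
    (hg : IsInvolutiveIsometry (gramPlus S) g) :
    orbitVec (extendInvolution S g hg) = Pi.single (Sum.inl ()) 1 ᵥ* g := by
  rw [orbitVec, coe_extendInvolution, projPlus_vecMul_extendMatrix, projPlus_ePlus]

variable (S) in
/-- The orbit map `Θ h ↦ e₊ h` onto the quadric. -/
def orbitMap : ThetaQuot S → Unit ⊕ Fin (n + 1) → K :=
  Quotient.lift orbitVec (by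
    intro a b hab
    have hθ : ePlus K n ᵥ* ((b * a⁻¹ : H S) : GL (Idx n) K).1 = ePlus K n :=
      QuotientGroup.rightRel_apply.mp hab
    have h : ePlus K n ᵥ* (b : GL (Idx n) K).1 = ePlus K n ᵥ* (a : GL (Idx n) K).1 := by
      calc ePlus K n ᵥ* (b : GL (Idx n) K).1
          = ePlus K n ᵥ* ((b * a⁻¹ * a : H S) : GL (Idx n) K).1 := by rw [inv_mul_cancel_right]
        _ = (ePlus K n ᵥ* ((b * a⁻¹ : H S) : GL (Idx n) K).1) ᵥ* (a : GL (Idx n) K).1 := by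
          rw [Matrix.vecMul_vecMul]; rfl
        _ = _ := by rw [hθ]
    rw [orbitVec, orbitVec, h])

theorem continuous_orbitVec : Continuous (orbitVec : H S → _) := by
  have h1 : Continuous fun h : H S => ePlus K n ᵥ* (h : GL (Idx n) K).1 :=
    continuous_const.matrix_vecMul (Units.continuous_val.comp continuous_subtype_val)
  exact continuous_pi fun i => (continuous_apply (splitIdx n (Sum.inl i))).comp h1

theorem continuous_orbitMap : Continuous (orbitMap S) := continuous_orbitVec.quotient_lift _

/-- Within $H$, the stabilizer of $e_+$ is exactly $\Theta$, and $e_+h$ has no $e_-$ component that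
the projection could lose. -/
theorem orbitMap_injective : Function.Injective (orbitMap S) := by
  intro x y
  refine Quotient.inductionOn₂ x y fun a b hab => ?_
  refine Quotient.sound (QuotientGroup.rightRel_apply.mpr ?_)
  change ePlus K n ᵥ* ((b * a⁻¹ : H S) : GL (Idx n) K).1 = ePlus K n
  rw [Subgroup.coe_mul, Units.val_mul, ← Matrix.vecMul_vecMul, ← ePlus_vecMul_injective hab,
    Matrix.vecMul_vecMul, ← Units.val_mul, ← Subgroup.coe_mul, mul_inv_cancel]
  simp

theorem qf_orbitMap (x : ThetaQuot S) : qf (gramPlus S) (orbitMap S x) = 1 :=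
  Quotient.inductionOn x qf_orbitVec

theorem orbitMap_translate (g : Matrix (Unit ⊕ Fin (n + 1)) (Unit ⊕ Fin (n + 1)) K)
    (hg : IsInvolutiveIsometry (gramPlus S) g) (x : ThetaQuot S) :
    orbitMap S (translate S (extendInvolution S g hg) x) = orbitMap S x ᵥ* g :=
  Quotient.inductionOn x fun h => orbitVec_mul_extendInvolution h g hg

theorem continuous_translate (h : H S) : Continuous (translate S h) :=
  (continuous_mul_const h).quotient_map' _

theorem continuous_extendInvolution {X : Type*} [TopologicalSpace X]
    {f : X → Matrix (Unit ⊕ Fin (n + 1)) (Unit ⊕ Fin (n + 1)) K} (hf : Continuous f)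
    (hg : ∀ x, IsInvolutiveIsometry (gramPlus S) (f x)) :
    Continuous fun x => extendInvolution S (f x) (hg x) := by
  have h1 : Continuous fun x => extendMatrix (f x) :=
    (hf.matrix_fromBlocks continuous_const continuous_const continuous_const).matrix_submatrix _ _
  -- The topology on `GL` also requires the inverse to vary continuously; for an involution the
  -- inverse is the same matrix.
  refine Continuous.subtype_mk (Units.continuous_iff.2 ⟨h1, h1⟩) _

variable [IsUltrametricDist K]

theorem one_le_norm_orbitVec (hS : ∀ i j, ‖S i j‖ ≤ 1) (h : H S) : 1 ≤ ‖orbitVec h‖ := by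
  refine one_le_norm_of_mem_nearOne (norm_gramPlus_le hS) ?_
  change ‖_ - _‖ < 1
  rw [qf_orbitVec]
  simp

/-- The extra $e_-$ coordinate is $1$ and never exceeds the norm of a point of the quadric. -/
theorem norm_vecMul_eq_norm_orbitVec (hS : ∀ i j, ‖S i j‖ ≤ 1) (h : H S) :
    ‖(ePlus K n + eMinus K n) ᵥ* (h : GL (Idx n) K).1‖ = ‖orbitVec h‖ := by
  rw [Matrix.add_vecMul, eMinus_vecMul]
  set w := ePlus K n ᵥ* (h : GL (Idx n) K).1 with hw
  have hp : projPlus (w + eMinus K n) = orbitVec h := by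
    change projPlus w + projPlus (eMinus K n) = _
    rw [projPlus_eMinus, add_zero]; rfl
  have hl : lastCoord (w + eMinus K n) = 1 := by
    change lastCoord w + lastCoord (eMinus K n) = 1
    rw [hw, lastCoord_ePlus_vecMul, lastCoord_eMinus, zero_add]
  rw [← hp]
  refine le_antisymm ((pi_norm_le_iff_of_nonneg (norm_nonneg _)).2 fun i => ?_)
    ((pi_norm_le_iff_of_nonneg (norm_nonneg _)).2 fun i => ?_)
  · rcases i with i | i | i
    · exact norm_le_pi_norm (projPlus (w + eMinus K n)) (Sum.inl i)
    · exact norm_le_pi_norm (projPlus (w + eMinus K n)) (Sum.inr i)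
    · change ‖lastCoord (w + eMinus K n)‖ ≤ _
      rw [hl, hp, norm_one]
      exact one_le_norm_orbitVec hS h
  · exact norm_le_pi_norm (w + eMinus K n) (splitIdx n (Sum.inl i))

variable [ProperSpace K]

theorem isCompact_near_quadric {ι : Type*} [Fintype ι] (B : Matrix ι ι K) (x : ι → K) :
    IsCompact {y | y ∈ Metric.ball x 1 ∧ qf B y = 1} :=
  (isCompact_closedBall x 1).of_isClosed_subset
    ((IsUltrametricDist.isClosed_ball x 1).inter (isClosed_eq (continuous_qf B) continuous_const))
    fun _ hy => Metric.ball_subset_closedBall hy.1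

/-- Over the compact set $Q\cap B(x,1)$, the negated reflection in $x+y$ is a continuous section of
the orbit map, and its image is the required compact set. This converts finiteness on compact sets
of $\Theta\backslash H$ into finiteness of the pushed-forward measure near $x$. -/
theorem exists_isCompact_orbitMap_preimage (hSs : S.IsSymm) (hS : ∀ i j, ‖S i j‖ ≤ 1)
    (h2 : ‖(2 : K)‖ = 1) :
    ∃ C : Set (ThetaQuot S), IsCompact C ∧
      orbitMap S ⁻¹' Metric.ball (Pi.single (Sum.inl ()) 1) 1 ⊆ C := by
  set x : Unit ⊕ Fin (n + 1) → K := Pi.single (Sum.inl ()) 1 with hx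
  let Y := {y | y ∈ Metric.ball x 1 ∧ qf (gramPlus S) y = 1}
  have hBs := isSymm_gramPlus hSs
  have hqx := qf_gramPlus_single S
  have hq : ∀ y : Y, qf (gramPlus S) (x + y) ≠ 0 := by
    intro y
    rw [← norm_pos_iff, norm_qf_add_eq_one hBs (norm_gramPlus_le hS) h2 hqx y.2.2
      (mem_ball_iff_norm.1 y.2.1)]
    exact one_pos
  have hinv : ∀ y : Y, IsInvolutiveIsometry (gramPlus S) (negReflection (gramPlus S) (x + y)) :=
    fun y => isInvolutiveIsometry_negReflection hBs (hq y)
  have hcont : Continuous fun y : Y => negReflection (gramPlus S) (x + y) := by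
    have h1 : Continuous fun y : Y => x + (y : Unit ⊕ Fin (n + 1) → K) :=
      continuous_const.add continuous_subtype_val
    refine Continuous.sub ?_ continuous_const
    refine (continuous_const.div ((continuous_qf _).comp h1) hq).smul ?_
    exact (continuous_const.matrix_mulVec h1).matrix_vecMulVec h1
  have : CompactSpace Y := isCompact_iff_compactSpace.1 (isCompact_near_quadric _ x)
  let σ : Y → ThetaQuot S := fun y => Quotient.mk _ (extendInvolution S _ (hinv y))
  have hσ : Continuous σ := continuous_quotient_mk'.comp (continuous_extendInvolution hcont hinv)
  refine ⟨Set.range σ, isCompact_range hσ, fun z hz => ?_⟩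
  refine ⟨⟨orbitMap S z, hz, qf_orbitMap z⟩, orbitMap_injective ?_⟩
  refine (orbitVec_extendInvolution _ _).trans ?_
  exact vecMul_negReflection_add hBs hqx (qf_orbitMap z) (hq ⟨_, hz, qf_orbitMap z⟩)

variable [MeasurableSpace K] [BorelSpace K]

theorem isQuadricMeasure_map_orbitMap (hSs : S.IsSymm) (hS : ∀ i j, ‖S i j‖ ≤ 1)
    (h2 : ‖(2 : K)‖ = 1) {μ : Measure (ThetaQuot S)} (hμ : IsInvariant S μ) :
    IsQuadricMeasure (gramPlus S) (Pi.single (Sum.inl ()) 1) (μ.map (orbitMap S)) := by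
  have hm : Measurable (orbitMap S) := continuous_orbitMap.measurable
  constructor
  · have hopen : IsOpen {v | qf (gramPlus S) v ≠ 1} :=
      isOpen_ne_fun (continuous_qf _) continuous_const
    rw [Measure.map_apply hm hopen.measurableSet, ← measure_empty (μ := μ)]
    congr 1
    exact Set.eq_empty_of_forall_notMem fun x hx => hx (qf_orbitMap x)
  · intro g hg
    have hcomm : (fun v => v ᵥ* g) ∘ orbitMap S =
        orbitMap S ∘ translate S (extendInvolution S g hg) :=
      funext fun x => (orbitMap_translate g hg x).symm
    rw [Measure.map_map (continuous_vecMul g).measurable hm, hcomm,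
      ← Measure.map_map hm (continuous_translate _).measurable, hμ.map_translate]
  · obtain ⟨C, hC, hsub⟩ := exists_isCompact_orbitMap_preimage hSs hS h2
    have := hμ.finiteOnCompacts
    rw [Measure.map_apply hm measurableSet_ball]
    exact ((measure_mono hsub).trans_lt hC.measure_lt_top).ne

theorem phiQuot_eq (hK : IsNormalizedAbs K) (hS : ∀ i j, ‖S i j‖ ≤ 1) (τ : Measure Kˣ)
    [τ.IsHaarMeasure] {s : ℂ} (hs : 0 < ((n + 1 : ℂ) * s).re) (x : ThetaQuot S) :
    phiQuot S τ s x = ((‖orbitMap S x‖ : ℝ) : ℂ) ^ (-((n + 1 : ℂ) * s)) := by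
  refine Quotient.inductionOn x fun h => ?_
  exact (phiNormalized_eq hK τ hs _).trans (by rw [norm_vecMul_eq_norm_orbitVec hS]; rfl)

end Quotient

/-! ### Identification with the local zeta and $L$-factors -/

section Factors

variable {K : Type*} [NontriviallyNormedField K] [IsUltrametricDist K]

/-- With $x=q^{r-\alpha}$ and $\alpha=(2r+1)s$, the exponents give $Z=1/(1-q^{2r-\alpha})$ and
$L=1/(1-\varepsilon x)$ above, and $1/(1-x^2)$ below. The identity is then $1-x^2=(1+\varepsilon
x)(1-\varepsilon x)$, and the bound on $\operatorname{Re}s$ ensures $\|x\|<1$, so that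
$1-\varepsilon x\ne0$. -/
theorem factors_eq (hK : IsNormalizedAbs K) (Δ : K) (r : ℕ) {s : ℂ}
    (hs : 2 * (r : ℝ) < (2 * (r : ℝ) + 1) * s.re) :
    (1 + quadChar Δ * (residueCard K : ℂ) ^ ((r : ℂ) - (2 * r + 1) * s)) /
        (1 - (residueCard K : ℂ) ^ ((2 * r : ℂ) - (2 * r + 1) * s)) =
      zetaFactor K ((2 * r + 1) * (s - 1) + 1) *
        LFactor Δ ((2 * r + 1) * (s - 1 / 2) + 1 / 2) /
        zetaFactor K ((2 * r + 1) * (2 * s - 1) + 1) := by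
  have hq := one_lt_residueCard_real hK
  have hq0 : (0 : ℝ) < residueCard K := by linarith
  set x : ℂ := (residueCard K : ℂ) ^ ((r : ℂ) - (2 * r + 1) * s) with hx
  have hxn : ‖x‖ < 1 := by
    rw [hx, show (residueCard K : ℂ) = ((residueCard K : ℝ) : ℂ) by simp,
      Complex.norm_cpow_eq_rpow_re_of_pos hq0]
    refine Real.rpow_lt_one_of_one_lt_of_neg hq ?_
    have : ((r : ℂ) - (2 * r + 1) * s).re = r - (2 * r + 1) * s.re := by simp
    rw [this]
    have : (0 : ℝ) ≤ r := Nat.cast_nonneg r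
    linarith
  have hε : (quadChar Δ : ℂ) ^ 2 = 1 := by
    rw [quadChar]; split_ifs <;> norm_num
  have hεn : ‖(quadChar Δ : ℂ)‖ = 1 := by
    rw [quadChar]; split_ifs <;> norm_num
  have h1 : 1 - (quadChar Δ : ℂ) * x ≠ 0 := by
    intro h
    have h' := congrArg norm (sub_eq_zero.1 h)
    rw [norm_mul, hεn, one_mul, norm_one] at h'
    linarith
  have e1 : -((2 * r + 1) * (s - 1) + 1) = (2 * r : ℂ) - (2 * r + 1) * s := by ring
  have e2 : -((2 * r + 1) * (s - 1 / 2) + 1 / 2) = (r : ℂ) - (2 * r + 1) * s := by ring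
  have e3 : (residueCard K : ℂ) ^ (-((2 * r + 1) * (2 * s - 1) + 1)) = x ^ 2 := by
    rw [hx, ← Complex.cpow_nat_mul]
    congr 1
    push_cast
    ring
  rw [zetaFactor, LFactor, zetaFactor, e1, e2, e3, ← hx, one_div (1 - x ^ 2), div_inv_eq_mul,
    div_mul_div_comm, one_mul, div_mul_eq_mul_div, one_mul,
    show 1 - x ^ 2 = (1 + quadChar Δ * x) * (1 - quadChar Δ * x) by linear_combination x ^ 2 * hε,
    mul_div_mul_right _ _ h1]

end Factors

end OrthogonalPeriod

end

/-! ### The period integral -/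

theorem propositionp {K : Type*} [NontriviallyNormedField K] [IsUltrametricDist K] [ProperSpace K]
    [MeasurableSpace K] [BorelSpace K] (hK : OrthogonalPeriod.IsNormalizedAbs K)
    (n : ℕ) (hn : Even n)
    (S : Matrix (Fin (n + 1)) (Fin (n + 1)) K) (hS : S.IsSymm)
    (h2 : ‖(2 : K)‖ = 1) (hint : ∀ i j, ‖S i j‖ ≤ 1) (hdet : ‖S.det‖ = 1)
    (τ : MeasureTheory.Measure Kˣ) [τ.IsHaarMeasure]
    (μ : MeasureTheory.Measure (OrthogonalPeriod.ThetaQuot S))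
    (hμ : OrthogonalPeriod.IsInvariant S μ) :
    ∃ C : ℝ, 0 < C ∧ ∀ s : ℂ, (n : ℝ) < ((n : ℝ) + 1) * s.re →
      (∀ h : OrthogonalPeriod.H S, MeasureTheory.Integrable
        (OrthogonalPeriod.integrand s (h : GL (OrthogonalPeriod.Idx n) K)) τ) ∧
      OrthogonalPeriod.phi τ s (1 : GL (OrthogonalPeriod.Idx n) K) ≠ 0 ∧
      MeasureTheory.Integrable (OrthogonalPeriod.phiQuot S τ s) μ ∧
      ∫ x, OrthogonalPeriod.phiQuot S τ s x ∂μ =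
        (C : ℂ) *
          (OrthogonalPeriod.zetaFactor K (((n : ℂ) + 1) * (s - 1) + 1) *
            OrthogonalPeriod.LFactor (OrthogonalPeriod.discr S)
              (((n : ℂ) + 1) * (s - 1 / 2) + 1 / 2) /
            OrthogonalPeriod.zetaFactor K (((n : ℂ) + 1) * (2 * s - 1) + 1)) := by
  obtain ⟨r, hr⟩ := hn
  have hm := (OrthogonalPeriod.continuous_orbitMap (S := S)).measurable
  have hμ' := OrthogonalPeriod.isQuadricMeasure_map_orbitMap hS hint h2 hμ
  have hμ0 : μ.map (OrthogonalPeriod.orbitMap S) ≠ 0 := by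
    rw [Ne, MeasureTheory.Measure.map_eq_zero_iff hm.aemeasurable]
    exact hμ.ne_zero
  have hcard : Fintype.card (Unit ⊕ Fin (n + 1)) = 2 * (r + 1) := by
    simp only [Fintype.card_sum, Fintype.card_unit, Fintype.card_fin]; omega
  have hdet' : ‖(OrthogonalPeriod.gramPlus S).det‖ = 1 := by
    rw [OrthogonalPeriod.det_gramPlus, hdet]
  have hx : ‖(Pi.single (Sum.inl ()) 1 : Unit ⊕ Fin (n + 1) → K)‖ ≤ 1 := by
    rw [Pi.norm_single, norm_one]
  obtain ⟨C, hC, hCα⟩ := hμ'.integral_norm_cpow hK h2 (OrthogonalPeriod.isSymm_gramPlus hS)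
    (OrthogonalPeriod.norm_gramPlus_le hint) hdet' hcard (OrthogonalPeriod.qf_gramPlus_single S)
    hx hμ0
  refine ⟨C, hC, fun s hs => ?_⟩
  have hnr : (n : ℝ) = 2 * r := by rw [hr]; push_cast; ring
  have hnc : (n : ℂ) = 2 * r := by rw [hr]; push_cast; ring
  have hre : ((n + 1 : ℂ) * s).re = ((n : ℝ) + 1) * s.re := by simp
  have hpos : 0 < ((n + 1 : ℂ) * s).re := by
    rw [hre]
    exact (Nat.cast_nonneg n).trans_lt hs
  -- With $\alpha=(n+1)s$ and $n=2r$, the convergence condition $2r<\operatorname{Re}\alpha$ is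
  -- exactly the hypothesis on $s$.
  obtain ⟨h1, h3⟩ := hCα ((n + 1 : ℂ) * s) (by rw [hre]; push_cast; rw [← hnr]; exact hs)
  have hφ : OrthogonalPeriod.phiQuot S τ s =
      (fun v => ((‖v‖ : ℝ) : ℂ) ^ (-((n + 1 : ℂ) * s))) ∘ OrthogonalPeriod.orbitMap S :=
    funext fun x => OrthogonalPeriod.phiQuot_eq hK hint τ hpos x
  refine ⟨fun h => OrthogonalPeriod.integrable_integrand hK τ hpos _, ?_, ?_, ?_⟩
  · rw [OrthogonalPeriod.phi_one]
    exact (OrthogonalPeriod.integral_tateIntegrand hK τ hpos).2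
  · rw [hφ]
    exact (MeasureTheory.integrable_map_measure h1.aestronglyMeasurable hm.aemeasurable).1 h1
  · rw [MeasureTheory.integral_map hm.aemeasurable h1.aestronglyMeasurable] at h3
    have hΔ : (-1) ^ (r + 1) * (OrthogonalPeriod.gramPlus S).det = OrthogonalPeriod.discr S := by
      rw [OrthogonalPeriod.discr, OrthogonalPeriod.det_gramPlus, show n / 2 = r by omega]
    rw [hφ]
    refine h3.trans ?_
    rw [hΔ, hnc, OrthogonalPeriod.factors_eq hK _ r (by rw [← hnr]; exact hs)]
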